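/- Let $n,m\ge 0$ and let $S=\langle(s_1,\mathtt{op}_1),\dots,(s_m,\mathtt{op}_m)\rangle$ be an update sequence with $s_t\in[n]$ and $\mathtt{op}_t\in\{\mathtt{access},\mathtt{insert},\mathtt{delete}\}$, in which every element of $[n]$ occurs at least once. **Executions.** A valid reconfiguration $\tau\to\tau'$ of a binary search tree (BST) $T_1$ into a BST $T_2$ replaces a part $\tau$ of $T_1$, which is empty or a connected subtree containing the root of $T_1$, by a tree $\tau'$ (empty or a connected subtree of $T_2$ containing its root) on the same elements as $\tau$, except that one element may be missing or newly added (and then not in $T_1$); the elements of $T_2$ are those of $T_1$ outside $\tau$ together with those of $\tau'$, and the child pointers of the elements of $T_1$ not in $\tau$ do not change. An execution $E=\langle T_0,\tau_1\to\tau_1',\dots,\tau_m\to\tau_m'\rangle$ of $S$ consists of a BST $T_0$ on elements of $[n]$ and valid reconfigurations $\tau_t\to\tau_t'$ of $T_{t-1}$ into a BST $T_t$ on elements of $[n]$ such that, as sets, $s_t\in\tau_t=\tau_t'$ if $\mathtt{op}_t=\mathtt{access}$, $\tau_t'=\{s_t\}\,\dot\cup\,\tau_t$ if $\mathtt{op}_t=\mathtt{insert}$,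 and $\tau_t=\{s_t\}\,\dot\cup\,\tau_t'$ if $\mathtt{op}_t=\mathtt{delete}$. Its set of touched points is $P(E)=\{(x,t)\mid x\in\tau_t\cup\tau_t'\}\subseteq[n]\times[m]$. **Point sets.** Write $p=(p_x,p_t)$ for points of $[n]\times[m]$. Let $A$, $I$, $D$ be the sets of points $(s_t,t)$ with $\mathtt{op}_t=\mathtt{access}$, $\mathtt{insert}$, $\mathtt{delete}$ respectively, $U=I\cup D$ and $P(S)=A\cup I\cup D$. For a point $p$ let $p'$ and $p''$ be the points of $U$ in the column of $p$ nearest to $p$ strictly below and strictly above $p$, if they exist. The point $p$ is *valid* if one of the following holds, where conditions on non-existing points are void: $p\notin U$, $p'\in I$, $p''\in D$; or $p\in I$, $p'\in D$, $p''\in D$; or $p\in D$, $p'\in I$, $p''\in I$. The points $\mathrm{pred}(p)$ and $\mathrm{succ}(p)$ are the nearest valid points in the row of $p$ strictly to the left and strictly to the right of $p$, if they exist. For a valid point $p$, the active time $\mathrm{act}(p)$ is the maximal interval $[t_{ins},t_{del}]$ of times containing $p_t$ such that all points $(p_x,t)$ with $t$ in this interval are valid, none of them except possibly $(p_x,t_{ins})$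 is in $I$, and none of them except possibly $(p_x,t_{del})$ is in $D$. For points $p,q$ let $\square_{pq}$ be the closed axis-parallel rectangle with opposite corners $p,q$. A set $P\subseteq[n]\times[m]$ is *(arboreally) satisfied* if $P\supseteq P(S)$, every point of $P$ is valid, and: 1. for all $p,q\in P$ with $p_t\le q_t$ that are both active from time $p_t$ to time $q_t$ (i.e. $[p_t,q_t]\subseteq\mathrm{act}(p)\cap\mathrm{act}(q)$), either $p_x=q_x$, or $p_t=q_t$, or there is a point $r\in(\square_{pq}\cap P)\setminus\{p,q\}$ such that $r\notin D$ if $r_t=p_t$, and $r\notin I$ if $r_t=q_t$; 2. for every $p\in U$ such that $\mathrm{pred}(p)$ and $\mathrm{succ}(p)$ both exist, $\mathrm{pred}(p)\in P$ or $\mathrm{succ}(p)\in P$. **Theorem.** A set $P\subseteq[n]\times[m]$ is satisfied if and only if $P=P(E)$ for some execution $E$ of $S$. -/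

import Mathlib

namespace GeoBST

/-! ### Binary search trees -/

section Trees

variable {α : Type*}

/-- The set of elements stored in a binary tree. -/
def keys : BinaryTree α → Set α
  | .nil => ∅
  | .node a l r => {a} ∪ keys l ∪ keys r

/-- The element at the root, if the tree is nonempty. -/
def root? : BinaryTree α → Option α
  | .nil => none
  | .node a _ _ => some a

/-- The binary search tree property (all elements are distinct). -/
def IsBST [LT α] : BinaryTree α → Prop
  | .nil => True
  | .node a l r => (∀ x ∈ keys l, x < a) ∧ (∀ x ∈ keys r, a < x) ∧ IsBST l ∧ IsBST r

/-- `IsTop τ T`: the tree `τ` is a connected part of `T` that contains the root of `T`,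
or is empty. It is obtained from `T` by cutting off some of the subtrees hanging below. -/
def IsTop : BinaryTree α → BinaryTree α → Prop
  | .nil, _ => True
  | .node _ _ _, .nil => False
  | .node a l r, .node b l' r' => a = b ∧ IsTop l l' ∧ IsTop r r'

/-- The left child pointer of the element `x` in the binary search tree `T`
(`none` is the null pointer, also used if `x` is not in `T`). -/
def leftChild [LinearOrder α] : BinaryTree α → α → Option α
  | .nil, _ => none
  | .node a l r, x =>
      if x < a then leftChild l x else if a < x then leftChild r x else root? l

/-- The right child pointer of the element `x` in the binary search tree `T`. -/
def rightChild [LinearOrder α] : BinaryTree α → α → Option α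
  | .nil, _ => none
  | .node a l r, x =>
      if x < a then rightChild l x else if a < x then rightChild r x else root? r

/-- The tree `T₁` can be reconfigured by the operation `τ → τ'` to the tree `T₂`: the top part `τ`
of `T₁` is replaced by `τ'`, which has the same elements except that one may be missing or newly
added, and the child pointers of the elements outside `τ` do not change. -/
structure ValidReconfiguration [LinearOrder α] (T₁ τ τ' T₂ : BinaryTree α) : Prop where
  bst_left : IsBST T₁
  bst_right : IsBST T₂
  top_left : IsTop τ T₁
  top_right : IsTop τ' T₂
  elements : keys τ' = keys τ ∨ (∃ y, y ∉ keys T₁ ∧ keys τ' = insert y (keys τ)) ∨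
    (∃ y, y ∉ keys τ' ∧ keys τ = insert y (keys τ'))
  keys_right : keys T₂ = (keys T₁ \ keys τ) ∪ keys τ'
  pointers : ∀ x ∈ keys T₁ \ keys τ,
    leftChild T₂ x = leftChild T₁ x ∧ rightChild T₂ x = rightChild T₁ x

end Trees

/-! ### Update sequences and executions

The elements are those of `Fin n` and the times those of `Fin m`. -/

/-- The three kinds of operations. -/
inductive Op
  | access
  | insert
  | delete

/-- An update sequence: at each time an element and an operation. -/
abbrev UpdateSeq (n m : ℕ) := Fin m → Fin n × Op

/-- An execution `⟨T₀, τ₁ → τ₁', …, τₘ → τₘ'⟩`. -/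
structure Execution (n m : ℕ) where
  init : BinaryTree (Fin n)
  before : Fin m → BinaryTree (Fin n)
  after : Fin m → BinaryTree (Fin n)

/-- What the operation at one time demands of the element sets of `τ` and `τ'`. -/
def Performs {n : ℕ} (τ τ' : BinaryTree (Fin n)) (s : Fin n) : Op → Prop
  | .access => s ∈ keys τ ∧ keys τ' = keys τ
  | .insert => s ∉ keys τ ∧ keys τ' = insert s (keys τ)
  | .delete => s ∉ keys τ' ∧ keys τ = insert s (keys τ')

/-- The execution `E` executes the update sequence `S`; here `T t.castSucc` and `T t.succ` are the
trees just before and just after the operation at time `t`. -/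
def Execution.Executes {n m : ℕ} (E : Execution n m) (S : UpdateSeq n m) : Prop :=
  ∃ T : Fin (m + 1) → BinaryTree (Fin n),
    T 0 = E.init ∧ (∀ i, IsBST (T i)) ∧
    ∀ t : Fin m,
      ValidReconfiguration (T t.castSucc) (E.before t) (E.after t) (T t.succ) ∧
      Performs (E.before t) (E.after t) (S t).1 (S t).2

/-- The geometric view `P(E)`: the set of points `(x, t)` such that `x` is touched at time `t`. -/
def Execution.points {n m : ℕ} (E : Execution n m) : Set (Fin n × Fin m) :=
  {p | p.1 ∈ keys (E.before p.2) ∪ keys (E.after p.2)}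

/-! ### Point sets -/

section Geometry

variable {n m : ℕ}

/-- Every element is accessed or updated at least once. -/
def UpdateSeq.UsesAll (S : UpdateSeq n m) : Prop := ∀ x : Fin n, ∃ t : Fin m, (S t).1 = x

/-- The access points `A(S)`. -/
def accessPts (S : UpdateSeq n m) : Set (Fin n × Fin m) := {p | S p.2 = (p.1, Op.access)}

/-- The insertion points `I(S)`. -/
def insertPts (S : UpdateSeq n m) : Set (Fin n × Fin m) := {p | S p.2 = (p.1, Op.insert)}

/-- The deletion points `D(S)`. -/
def deletePts (S : UpdateSeq n m) : Set (Fin n × Fin m) := {p | S p.2 = (p.1, Op.delete)}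

/-- The update points `U(S)`. -/
def updatePts (S : UpdateSeq n m) : Set (Fin n × Fin m) := insertPts S ∪ deletePts S

/-- The geometric view `P(S)` of the update sequence. -/
def seqPts (S : UpdateSeq n m) : Set (Fin n × Fin m) := accessPts S ∪ insertPts S ∪ deletePts S

/-- `p'` is the update point nearest to `p` below `p`. -/
def NearestBelow (S : UpdateSeq n m) (p p' : Fin n × Fin m) : Prop :=
  p' ∈ updatePts S ∧ p'.1 = p.1 ∧ p'.2 < p.2 ∧
    ∀ u ∈ updatePts S, u.1 = p.1 → u.2 < p.2 → u.2 ≤ p'.2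

/-- `p''` is the update point nearest to `p` above `p`. -/
def NearestAbove (S : UpdateSeq n m) (p p'' : Fin n × Fin m) : Prop :=
  p'' ∈ updatePts S ∧ p''.1 = p.1 ∧ p.2 < p''.2 ∧
    ∀ u ∈ updatePts S, u.1 = p.1 → p.2 < u.2 → p''.2 ≤ u.2

/-- The point `p` is valid in `P(S)`. -/
def ValidPoint (S : UpdateSeq n m) (p : Fin n × Fin m) : Prop :=
  (p ∉ updatePts S ∧
    (∀ p', NearestBelow S p p' → p' ∈ insertPts S) ∧
    (∀ p'', NearestAbove S p p'' → p'' ∈ deletePts S)) ∨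
  (p ∈ insertPts S ∧
    (∀ p', NearestBelow S p p' → p' ∈ deletePts S) ∧
    (∀ p'', NearestAbove S p p'' → p'' ∈ deletePts S)) ∨
  (p ∈ deletePts S ∧
    (∀ p', NearestBelow S p p' → p' ∈ insertPts S) ∧
    (∀ p'', NearestAbove S p p'' → p'' ∈ insertPts S))

/-- `p' = pred(p)`: the nearest valid point to the left of `p` in the same row. -/
def IsPred (S : UpdateSeq n m) (p p' : Fin n × Fin m) : Prop :=
  ValidPoint S p' ∧ p'.2 = p.2 ∧ p'.1 < p.1 ∧
    ∀ y, y < p.1 → ValidPoint S (y, p.2) → y ≤ p'.1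

/-- `p' = succ(p)`: the nearest valid point to the right of `p` in the same row. -/
def IsSucc (S : UpdateSeq n m) (p p' : Fin n × Fin m) : Prop :=
  ValidPoint S p' ∧ p'.2 = p.2 ∧ p.1 < p'.1 ∧
    ∀ y, p.1 < y → ValidPoint S (y, p.2) → p'.1 ≤ y

/-- The set `P` contains `P(S)` and all of its points are valid. -/
def ValidSet (S : UpdateSeq n m) (P : Set (Fin n × Fin m)) : Prop :=
  seqPts S ⊆ P ∧ ∀ p ∈ P, ValidPoint S p

/-- On the whole interval `[a, b]` of times the points of column `x` are valid and belong to one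
lifetime of `x`: an insertion of `x` can only be at time `a` and a deletion only at time `b`. -/
def ActiveRun (S : UpdateSeq n m) (x : Fin n) (a b : Fin m) : Prop :=
  ∀ t ∈ Set.Icc a b, ValidPoint S (x, t) ∧
    ((x, t) ∈ insertPts S → t = a) ∧ ((x, t) ∈ deletePts S → t = b)

/-- The active time `act(p)` of `p`, the maximal interval `[t_ins(p), t_del(p)]` around `p_t` that
is an active run (the union of all active runs containing `p_t`). -/
def act (S : UpdateSeq n m) (p : Fin n × Fin m) : Set (Fin m) :=
  {t | ∃ a b, ActiveRun S p.1 a b ∧ p.2 ∈ Set.Icc a b ∧ t ∈ Set.Icc a b}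

/-- The points `p`, `q` are both active from time `p_t` to time `q_t`. -/
def ActivePair (S : UpdateSeq n m) (p q : Fin n × Fin m) : Prop :=
  p.2 ≤ q.2 ∧ Set.Icc p.2 q.2 ⊆ act S p ∧ Set.Icc p.2 q.2 ⊆ act S q

/-- The closed axis-parallel rectangle with opposite corners `p` and `q`. -/
def rect (p q : Fin n × Fin m) : Set (Fin n × Fin m) :=
  Set.uIcc p.1 q.1 ×ˢ Set.uIcc p.2 q.2

/-- The point set `P` is (arboreally) satisfied, with respect to the update sequence `S`. -/
def Satisfied (S : UpdateSeq n m) (P : Set (Fin n × Fin m)) : Prop :=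
  ValidSet S P ∧
  (∀ p ∈ P, ∀ q ∈ P, ActivePair S p q →
    p.1 = q.1 ∨ p.2 = q.2 ∨
    ∃ r ∈ (rect p q ∩ P) \ {p, q},
      (r.2 = p.2 → r ∉ deletePts S) ∧ (r.2 = q.2 → r ∉ insertPts S)) ∧
  (∀ p ∈ updatePts S, ∀ a b, IsPred S p a → IsSucc S p b → a ∈ P ∨ b ∈ P)

end Geometry

end GeoBST

namespace GeoBST

/-! ### Ancestors in binary search trees -/

section Ancestors

variable {α : Type*}

/-! The link between trees and point sets is that a top part of a tree is closed under ancestors,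
and that elements outside the touched part keep their child pointers, hence their descendants.

From an execution to satisfaction (`Execution.Executes.satisfied`): for condition 1, the lowest
common ancestor `z` of two elements `x`, `y` just after `x` is touched is touched as well. Either `z
≠ x` is the third point, or `x` is an ancestor of `y` and, unless touched again, remains one until
`y` is touched, which touches `x`. For condition 2, if pred and succ of an updated element were both
untouched, one would be an ancestor of the other, and the updated element, lying between them, would
hang below an untouched one.

From a satisfied set to an execution (`Satisfied.exists_execution`): the tree before time `t` is a
treap whose priority is the next touch time from `t` on, so the elements touched at `t` form a top
part. They are rebuilt as a treap for the next touch times after `t`, and the untouched subtrees are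
hung back below (`exists_graft`). Condition 2 makes these subtrees fit the gaps of the new top part,
and `Satisfied.nextTouch_le_nextTouch`, resting on both conditions, shows that the result is again a
treap.

Both directions translate validity and active times into presence of elements:
`Lifetimes.validPoint_iff` and `Lifetimes.activePair_iff`. -/

theorem mem_keys_node {x a : α} {l r : BinaryTree α} :
    x ∈ keys (.node a l r) ↔ x = a ∨ x ∈ keys l ∨ x ∈ keys r := by
  simp [keys, or_assoc]

theorem IsTop.keys_subset {τ T : BinaryTree α} (h : IsTop τ T) : keys τ ⊆ keys T := by
  induction τ generalizing T with
  | nil => simp [keys]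
  | node a l r ihl ihr =>
    cases T with
    | nil => exact h.elim
    | node b l' r' =>
      obtain ⟨rfl, hl, hr⟩ := h
      intro x hx
      rw [mem_keys_node] at hx ⊢
      exact hx.imp_right (Or.imp (fun h => ihl hl h) (fun h => ihr hr h))

theorem mem_keys_of_root?_eq {T : BinaryTree α} {a : α} (h : root? T = some a) : a ∈ keys T := by
  cases T with
  | nil => simp [root?] at h
  | node b l r => simp_all [root?, keys]

variable [LinearOrder α]

/-- The element `y` is a child of `x` in the binary search tree `T`. -/
def IsChild (T : BinaryTree α) (x y : α) : Prop :=
  leftChild T x = some y ∨ rightChild T x = some y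

/-- The element `x` is an ancestor of `y` (or equal to it) in the binary search tree `T`. -/
def Anc (T : BinaryTree α) : α → α → Prop := Relation.ReflTransGen (IsChild T)

theorem isChild_node_of_lt {a x y : α} {l r : BinaryTree α} (h : x < a) :
    IsChild (.node a l r) x y ↔ IsChild l x y := by
  simp [IsChild, leftChild, rightChild, h]

theorem isChild_node_of_gt {a x y : α} {l r : BinaryTree α} (h : a < x) :
    IsChild (.node a l r) x y ↔ IsChild r x y := by
  simp [IsChild, leftChild, rightChild, h, h.not_gt]

theorem isChild_node_self {a y : α} {l r : BinaryTree α} :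
    IsChild (.node a l r) a y ↔ root? l = some y ∨ root? r = some y := by
  simp [IsChild, leftChild, rightChild]

theorem IsChild.mem_keys {T : BinaryTree α} {x y : α} (h : IsChild T x y) :
    x ∈ keys T ∧ y ∈ keys T := by
  induction T with
  | nil => simp [IsChild, leftChild, rightChild] at h
  | node a l r ihl ihr =>
    simp only [mem_keys_node]
    rcases lt_trichotomy x a with hx | rfl | hx
    · have := ihl ((isChild_node_of_lt hx).1 h); tauto
    · rcases isChild_node_self.1 h with h | h <;> have := mem_keys_of_root?_eq h <;> tauto
    · have := ihr ((isChild_node_of_gt hx).1 h); tauto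

theorem Anc.mem_keys {T : BinaryTree α} {x y : α} (h : Anc T x y) (hx : x ∈ keys T) :
    y ∈ keys T := by
  induction h with
  | refl => exact hx
  | tail _ h _ => exact h.mem_keys.2

theorem Anc.node_left {a x y : α} {l r : BinaryTree α} (hT : IsBST (.node a l r))
    (h : Anc l x y) : Anc (.node a l r) x y :=
  Relation.ReflTransGen.mono
    (fun _ _ huv => (isChild_node_of_lt (hT.1 _ huv.mem_keys.1)).2 huv) _ _ h

theorem Anc.node_right {a x y : α} {l r : BinaryTree α} (hT : IsBST (.node a l r))
    (h : Anc r x y) : Anc (.node a l r) x y :=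
  Relation.ReflTransGen.mono
    (fun _ _ huv => (isChild_node_of_gt (hT.2.1 _ huv.mem_keys.1)).2 huv) _ _ h

theorem anc_of_root? {T : BinaryTree α} (hT : IsBST T) {a y : α} (ha : root? T = some a)
    (hy : y ∈ keys T) : Anc T a y := by
  induction T generalizing a with
  | nil => simp [root?] at ha
  | node b l r ihl ihr =>
    obtain rfl : b = a := by simpa [root?] using ha
    rcases mem_keys_node.1 hy with rfl | h | h
    · exact .refl
    · cases hl : root? l with
      | none => cases l <;> simp_all [root?, keys]
      | some c =>
        exact .head (isChild_node_self.2 (.inl hl)) ((ihl hT.2.2.1 hl h).node_left hT)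
    · cases hr : root? r with
      | none => cases r <;> simp_all [root?, keys]
      | some c =>
        exact .head (isChild_node_self.2 (.inr hr)) ((ihr hT.2.2.2 hr h).node_right hT)

theorem Anc.of_node_left {a x y : α} {l r : BinaryTree α} (hT : IsBST (.node a l r))
    (h : Anc (.node a l r) x y) (hx : x ∈ keys l) : Anc l x y ∧ y ∈ keys l := by
  induction h with
  | refl => exact ⟨.refl, hx⟩
  | tail _ h ih =>
    have h' := (isChild_node_of_lt (hT.1 _ ih.2)).1 h
    exact ⟨ih.1.tail h', h'.mem_keys.2⟩

theorem Anc.of_node_right {a x y : α} {l r : BinaryTree α} (hT : IsBST (.node a l r))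
    (h : Anc (.node a l r) x y) (hx : x ∈ keys r) : Anc r x y ∧ y ∈ keys r := by
  induction h with
  | refl => exact ⟨.refl, hx⟩
  | tail _ h ih =>
    have h' := (isChild_node_of_gt (hT.2.1 _ ih.2)).1 h
    exact ⟨ih.1.tail h', h'.mem_keys.2⟩

/-- The descendants of `x` form an interval of the elements of the tree. -/
theorem Anc.of_mem_uIcc {T : BinaryTree α} (hT : IsBST T) {x y w : α} (h : Anc T x y)
    (hx : x ∈ keys T) (hw : w ∈ keys T) (hxy : w ∈ Set.uIcc x y) : Anc T x w := by
  induction T with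
  | nil => simp [keys] at hx
  | node a l r ihl ihr =>
    have key : ∀ z ∈ keys (.node a l r), (z < a → z ∈ keys l) ∧ (a < z → z ∈ keys r) := by
      intro z hz
      rcases mem_keys_node.1 hz with rfl | h | h
      · simp
      · exact ⟨fun _ => h, fun h' => absurd (hT.1 _ h) h'.not_gt⟩
      · exact ⟨fun h' => absurd (hT.2.1 _ h) h'.not_gt, fun _ => h⟩
    rcases mem_keys_node.1 hx with rfl | hx' | hx'
    · exact anc_of_root? hT rfl hw
    · obtain ⟨h1, h2⟩ := h.of_node_left hT hx'
      have hwa : w < a := hxy.2.trans_lt (max_lt (hT.1 _ hx') (hT.1 _ h2))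
      exact (ihl hT.2.2.1 h1 hx' ((key w hw).1 hwa)).node_left hT
    · obtain ⟨h1, h2⟩ := h.of_node_right hT hx'
      have hwa : a < w := (lt_min (hT.2.1 _ hx') (hT.2.1 _ h2)).trans_le hxy.1
      exact (ihr hT.2.2.2 h1 hx' ((key w hw).2 hwa)).node_right hT

/-- Lowest common ancestors. -/
theorem exists_anc_of_le {T : BinaryTree α} (hT : IsBST T) {x y : α} (hx : x ∈ keys T)
    (hy : y ∈ keys T) (hxy : x ≤ y) :
    ∃ z ∈ keys T, x ≤ z ∧ z ≤ y ∧ Anc T z x ∧ Anc T z y := by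
  induction T with
  | nil => simp [keys] at hx
  | node a l r ihl ihr =>
    by_cases h1 : a < x
    · have hx' : x ∈ keys r := by
        rcases mem_keys_node.1 hx with rfl | h | h
        exacts [absurd h1 (lt_irrefl _), absurd (hT.1 _ h) h1.not_gt, h]
      have hy' : y ∈ keys r := by
        rcases mem_keys_node.1 hy with rfl | h | h
        exacts [absurd h1 hxy.not_gt, absurd (hT.1 _ h) (h1.trans_le hxy).not_gt, h]
      obtain ⟨z, hz, h⟩ := ihr hT.2.2.2 hx' hy'
      exact ⟨z, mem_keys_node.2 (by tauto), h.1, h.2.1, h.2.2.1.node_right hT,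
        h.2.2.2.node_right hT⟩
    by_cases h2 : y < a
    · have hx' : x ∈ keys l := by
        rcases mem_keys_node.1 hx with rfl | h | h
        exacts [absurd h2 hxy.not_gt, h, absurd (hT.2.1 _ h) (hxy.trans_lt h2).not_gt]
      have hy' : y ∈ keys l := by
        rcases mem_keys_node.1 hy with rfl | h | h
        exacts [absurd h2 (lt_irrefl _), h, absurd (hT.2.1 _ h) h2.not_gt]
      obtain ⟨z, hz, h⟩ := ihl hT.2.2.1 hx' hy'
      exact ⟨z, mem_keys_node.2 (by tauto), h.1, h.2.1, h.2.2.1.node_left hT,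
        h.2.2.2.node_left hT⟩
    exact ⟨a, mem_keys_node.2 (.inl rfl), not_lt.1 h1, not_lt.1 h2, anc_of_root? hT rfl hx,
      anc_of_root? hT rfl hy⟩

theorem exists_anc_mem_uIcc {T : BinaryTree α} (hT : IsBST T) {x y : α} (hx : x ∈ keys T)
    (hy : y ∈ keys T) : ∃ z ∈ keys T, z ∈ Set.uIcc x y ∧ Anc T z x ∧ Anc T z y := by
  rcases le_total x y with h | h
  · obtain ⟨z, hz, h1, h2, h3⟩ := exists_anc_of_le hT hx hy h
    exact ⟨z, hz, by rw [Set.uIcc_of_le h]; exact ⟨h1, h2⟩, h3⟩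
  · obtain ⟨z, hz, h1, h2, h3⟩ := exists_anc_of_le hT hy hx h
    exact ⟨z, hz, by rw [Set.uIcc_of_ge h]; exact ⟨h1, h2⟩, h3.symm⟩

/-! ### Ancestors, top parts and reconfigurations. -/

theorem IsTop.mem_of_isChild {τ T : BinaryTree α} (hT : IsBST T) (h : IsTop τ T) {x y : α}
    (hxy : IsChild T x y) (hy : y ∈ keys τ) : x ∈ keys τ := by
  induction τ generalizing T with
  | nil => simp [keys] at hy
  | node a l r ihl ihr =>
    cases T with
    | nil => exact h.elim
    | node b l' r' =>
      obtain ⟨rfl, hl, hr⟩ := h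
      rw [mem_keys_node] at hy ⊢
      rcases lt_trichotomy x a with hx | rfl | hx
      · have h' := (isChild_node_of_lt hx).1 hxy
        have hya := hT.1 _ h'.mem_keys.2
        rcases hy with rfl | hy | hy
        · exact absurd hya (lt_irrefl _)
        · exact .inr (.inl (ihl hT.2.2.1 hl h' hy))
        · exact absurd hya (hT.2.1 _ (hr.keys_subset hy)).not_gt
      · exact .inl rfl
      · have h' := (isChild_node_of_gt hx).1 hxy
        have hya := hT.2.1 _ h'.mem_keys.2
        rcases hy with rfl | hy | hy
        · exact absurd hya (lt_irrefl _)
        · exact absurd hya (hT.1 _ (hl.keys_subset hy)).not_gt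
        · exact .inr (.inr (ihr hT.2.2.2 hr h' hy))

theorem IsTop.mem_of_anc {τ T : BinaryTree α} (hT : IsBST T) (h : IsTop τ T) {x y : α}
    (hxy : Anc T x y) (hy : y ∈ keys τ) : x ∈ keys τ := by
  induction hxy with
  | refl => exact hy
  | tail _ hc ih => exact ih (h.mem_of_isChild hT hc hy)

/-- Top parts are closed under ancestors, so all descendants of an untouched element are untouched
too, and every pointer on the path from `x` down to `y` survives. -/
theorem ValidReconfiguration.anc_right {T₁ τ τ' T₂ : BinaryTree α}
    (h : ValidReconfiguration T₁ τ τ' T₂) {x y : α} (hx : x ∈ keys T₁) (hxτ : x ∉ keys τ)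
    (hxy : Anc T₁ x y) : Anc T₂ x y := by
  induction hxy with
  | refl => exact .refl
  | @tail u v hu hc ih =>
    obtain ⟨h1, h2⟩ := h.pointers u
      ⟨Anc.mem_keys hu hx, fun hu' => hxτ (h.top_left.mem_of_anc h.bst_left hu hu')⟩
    exact ih.tail (by rwa [IsChild, h1, h2])

theorem ValidReconfiguration.anc_left {T₁ τ τ' T₂ : BinaryTree α}
    (h : ValidReconfiguration T₁ τ τ' T₂) {x y : α} (hx : x ∈ keys T₂) (hxτ : x ∉ keys τ')
    (hxy : Anc T₂ x y) : Anc T₁ x y := by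
  induction hxy with
  | refl => exact .refl
  | @tail u v hu hc ih =>
    have hu1 : u ∉ keys τ' := fun hu' => hxτ (h.top_right.mem_of_anc h.bst_right hu hu')
    have hu2 : u ∈ keys T₂ := Anc.mem_keys hu hx
    rw [h.keys_right] at hu2
    obtain ⟨h1, h2⟩ := h.pointers u (hu2.resolve_right hu1)
    exact ih.tail (by rwa [IsChild, h1, h2] at hc)

end Ancestors

end GeoBST

namespace GeoBST

/-! ### Heap-ordered search trees -/

section Heaps

variable {α : Type*}

theorem finite_keys (T : BinaryTree α) : (keys T).Finite := by
  induction T with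
  | nil => exact Set.finite_empty
  | node a l r ihl ihr => exact ((Set.finite_singleton a).union ihl).union ihr

/-- The tree is heap-ordered with respect to the priorities `N`, the smallest one at the root. -/
def IsHeap (N : α → ℕ) : BinaryTree α → Prop
  | .nil => True
  | .node a l r => (∀ x ∈ keys l, N a ≤ N x) ∧ (∀ x ∈ keys r, N a ≤ N x) ∧ IsHeap N l ∧ IsHeap N r

theorem IsHeap.congr {N N' : α → ℕ} {T : BinaryTree α} (h : IsHeap N T)
    (hN : ∀ x ∈ keys T, N x = N' x) : IsHeap N' T := by
  induction T with
  | nil => trivial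
  | node a l r ihl ihr =>
    simp only [mem_keys_node] at hN
    refine ⟨fun x hx => ?_, fun x hx => ?_, ihl h.2.2.1 fun x hx => hN x (by tauto),
      ihr h.2.2.2 fun x hx => hN x (by tauto)⟩
    · rw [← hN a (by tauto), ← hN x (by tauto)]; exact h.1 x hx
    · rw [← hN a (by tauto), ← hN x (by tauto)]; exact h.2.1 x hx

/-- Priorities do not decrease downwards, so once a node exceeds `c` its whole subtree can be cut
off. With next touch times as priorities and `c` the current time, this yields the touched part. -/
theorem IsHeap.exists_isTop {N : α → ℕ} {T : BinaryTree α} (h : IsHeap N T) (c : ℕ) :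
    ∃ τ, IsTop τ T ∧ keys τ = {x ∈ keys T | N x ≤ c} := by
  induction T with
  | nil => exact ⟨.nil, trivial, by simp [keys]⟩
  | node a l r ihl ihr =>
    by_cases ha : N a ≤ c
    · obtain ⟨τl, h1, h2⟩ := ihl h.2.2.1
      obtain ⟨τr, h3, h4⟩ := ihr h.2.2.2
      refine ⟨.node a τl τr, ⟨rfl, h1, h3⟩, ?_⟩
      ext x
      simp only [mem_keys_node, h2, h4, Set.mem_ofPred_eq]
      constructor
      · rintro (rfl | h | h) <;> tauto
      · tauto
    · refine ⟨.nil, trivial, ?_⟩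
      ext x
      simp only [mem_keys_node, Set.mem_ofPred_eq]
      constructor
      · simp [keys]
      · rintro ⟨rfl | hx | hx, hc⟩
        · exact absurd hc ha
        · exact absurd ((h.1 x hx).trans hc) ha
        · exact absurd ((h.2.1 x hx).trans hc) ha

theorem exists_isBST_isHeap [LinearOrder α] (N : α → ℕ) (F : Finset α) :
    ∃ T : BinaryTree α, IsBST T ∧ keys T = F ∧ IsHeap N T := by
  induction F using Finset.strongInduction with
  | H F ih =>
    rcases F.eq_empty_or_nonempty with rfl | hF
    · exact ⟨.nil, trivial, by simp [keys], trivial⟩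
    obtain ⟨a, ha, hmin⟩ := F.exists_min_image N hF
    obtain ⟨l, hl, hlk, hlh⟩ := ih (F.filter (· < a))
      (Finset.filter_ssubset.2 ⟨a, ha, lt_irrefl a⟩)
    obtain ⟨r, hr, hrk, hrh⟩ := ih (F.filter (a < ·))
      (Finset.filter_ssubset.2 ⟨a, ha, lt_irrefl a⟩)
    have hl' : ∀ x, x ∈ keys l ↔ x ∈ F ∧ x < a := by simp [hlk]
    have hr' : ∀ x, x ∈ keys r ↔ x ∈ F ∧ a < x := by simp [hrk]
    refine ⟨.node a l r, ⟨fun x hx => ((hl' x).1 hx).2, fun x hx => ((hr' x).1 hx).2, hl, hr⟩, ?_,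
      fun x hx => hmin x ((hl' x).1 hx).1, fun x hx => hmin x ((hr' x).1 hx).1, hlh, hrh⟩
    ext x
    rw [mem_keys_node, hl', hr', Finset.mem_coe]
    rcases lt_trichotomy x a with h | rfl | h
    · simp [h, h.ne, h.not_gt]
    · simp [ha]
    · simp [h, h.ne', h.not_gt]

end Heaps

/-! ### Replacing the top part of a tree -/

section Graft

variable {α : Type*} [LinearOrder α]

/-- The element `z` is strictly between `x` and `y`. -/
def Between (x z y : α) : Prop := (x < z ∧ z < y) ∨ (y < z ∧ z < x)

/-- `C` consists of all elements of `R` in one of the gaps of `F`. -/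
def IsGap (F R C : Set α) : Prop :=
  C ⊆ R ∧ ∀ x ∈ C, ∀ y ∈ R, y ∈ C ↔ ∀ z ∈ F, ¬ Between x z y

/-- `H` is a heap-ordered search tree on `C` with the same child pointers as `T`. -/
structure IsPart (N : α → ℕ) (T : BinaryTree α) (C : Set α) (H : BinaryTree α) : Prop where
  bst : IsBST H
  keys_eq : keys H = C
  heap : IsHeap N H
  pointers : ∀ x ∈ C, leftChild H x = leftChild T x ∧ rightChild H x = rightChild T x

/-- The elements outside a top part in one of its gaps form a hanging subtree. -/
theorem IsTop.exists_isPart {N : α → ℕ} {τ T : BinaryTree α} (h : IsTop τ T) (hT : IsBST T)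
    (hN : IsHeap N T) {C : Set α} (hC : IsGap (keys τ) (keys T \ keys τ) C) :
    ∃ H, IsPart N T C H := by
  -- The empty set is a gap vacuously. In a nonempty gap, the position of `c` relative to the root
  -- decides into which subtree the recursion goes.
  rcases C.eq_empty_or_nonempty with rfl | ⟨c, hc⟩
  · exact ⟨.nil, trivial, rfl, trivial, by simp⟩
  induction τ generalizing T with
  | nil =>
    refine ⟨T, hT, ?_, hN, fun _ _ => ⟨rfl, rfl⟩⟩
    refine (Set.Subset.antisymm (fun x hx => (hC.1 hx).1) fun y hy => ?_).symm
    exact (hC.2 c hc y ⟨hy, by simp [keys]⟩).2 (by simp [keys])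
  | node a l r ihl ihr =>
    cases T with
    | nil => exact h.elim
    | node b l' r' =>
      obtain ⟨rfl, hl, hr⟩ := h
      have haτ : a ∈ keys (.node a l r) := mem_keys_node.2 (.inl rfl)
      have hlk : ∀ z ∈ keys l, z < a := fun z hz => hT.1 z (hl.keys_subset hz)
      have hrk : ∀ z ∈ keys r, a < z := fun z hz => hT.2.1 z (hr.keys_subset hz)
      have hne : ∀ x ∈ C, x ≠ a := by rintro x hx rfl; exact (hC.1 hx).2 haτ
      -- The root of the top part separates no two elements of a gap, so `C` lies on one side of it.
      have hgap : ∀ x ∈ C, ∀ y ∈ C, ¬ Between x a y := fun x hx y hy =>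
        (hC.2 x hx y (hC.1 hy)).1 hy a haτ
      rcases lt_or_gt_of_ne (hne c hc) with hca | hca
      · have hCa : ∀ x ∈ C, x < a := fun x hx => (hne x hx).lt_or_gt.resolve_right
          fun h => hgap c hc x hx (.inl ⟨hca, h⟩)
        have hmem : ∀ y, y < a → (y ∈ keys (.node a l' r') \ keys (.node a l r) ↔
            y ∈ keys l' \ keys l) := by
          intro y hy
          have h1 : y ∉ keys r' := fun h => (hT.2.1 y h).not_gt hy
          have h2 : y ∉ keys r := fun h => (hrk y h).not_gt hy
          simp [mem_keys_node, h1, h2, hy.ne]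
        obtain ⟨H, h1, h2, h3, h4⟩ := ihl hl hT.2.2.1 hN.2.2.1 
          ⟨fun x hx => (hmem x (hCa x hx)).1 (hC.1 hx), fun x hx y hy => by
            have hya := hT.1 y hy.1
            rw [hC.2 x hx y ((hmem y hya).2 hy)]
            refine ⟨fun h z hz => h z (mem_keys_node.2 (by tauto)), fun h z hz => ?_⟩
            have hxa := hCa x hx
            rcases mem_keys_node.1 hz with rfl | hz | hz
            · rintro (h | h); exacts [h.2.not_gt hya, h.2.not_gt hxa]
            · exact h z hz
            · have := hrk z hz
              rintro (h | h)
              exacts [(this.trans h.2).not_gt hya, (this.trans h.2).not_gt hxa]⟩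
        refine ⟨H, h1, h2, h3, fun x hx => ?_⟩
        simp [h4 x hx, leftChild, rightChild, hCa x hx]
      · have hCa : ∀ x ∈ C, a < x := fun x hx => (hne x hx).lt_or_gt.resolve_left
          fun h => hgap c hc x hx (.inr ⟨h, hca⟩)
        have hmem : ∀ y, a < y → (y ∈ keys (.node a l' r') \ keys (.node a l r) ↔
            y ∈ keys r' \ keys r) := by
          intro y hy
          have h1 : y ∉ keys l' := fun h => (hT.1 y h).not_gt hy
          have h2 : y ∉ keys l := fun h => (hlk y h).not_gt hy
          simp [mem_keys_node, h1, h2, hy.ne']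
        obtain ⟨H, h1, h2, h3, h4⟩ := ihr hr hT.2.2.2 hN.2.2.2 
          ⟨fun x hx => (hmem x (hCa x hx)).1 (hC.1 hx), fun x hx y hy => by
            have hya := hT.2.1 y hy.1
            rw [hC.2 x hx y ((hmem y hya).2 hy)]
            refine ⟨fun h z hz => h z (mem_keys_node.2 (by tauto)), fun h z hz => ?_⟩
            have hxa := hCa x hx
            rcases mem_keys_node.1 hz with rfl | hz | hz
            · rintro (h | h); exacts [h.1.not_gt hxa, h.1.not_gt hya]
            · have := hlk z hz
              rintro (h | h)
              exacts [(h.1.trans this).not_gt hxa, (h.1.trans this).not_gt hya]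
            · exact h z hz⟩
        refine ⟨H, h1, h2, h3, fun x hx => ?_⟩
        simp [h4 x hx, leftChild, rightChild, hCa x hx, (hCa x hx).not_gt]

/-- Among the elements of `F` on the same side of `x` as `a`, the one nearest to `x` has nothing of
`F` between itself and `x`. Thus heap order towards a hanging element need only be checked at its
neighbours in the top part. -/
theorem IsHeap.le_of_adjacent {N : α → ℕ} {F : Set α} (hF : F.Finite) {a x : α}
    (hNa : ∀ z ∈ F, N a ≤ N z) (ha : a ∈ F)
    (hadj : ∀ q ∈ F, (∀ z ∈ F, ¬ Between q z x) → N q ≤ N x) : N a ≤ N x := by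
  rcases le_total a x with h | h
  · obtain ⟨q, ⟨hq1, hq2⟩, hq⟩ := Set.exists_max_image {z ∈ F | z ≤ x} id
      (hF.subset (Set.sep_subset _ _)) ⟨a, ha, h⟩
    refine (hNa q hq1).trans (hadj q hq1 fun z hz hb => ?_)
    rcases hb with hb | hb
    · exact (hq z ⟨hz, hb.2.le⟩).not_gt hb.1
    · exact hq2.not_gt (hb.1.trans hb.2)
  · obtain ⟨q, ⟨hq1, hq2⟩, hq⟩ := Set.exists_min_image {z ∈ F | x ≤ z} id
      (hF.subset (Set.sep_subset _ _)) ⟨a, ha, h⟩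
    refine (hNa q hq1).trans (hadj q hq1 fun z hz hb => ?_)
    rcases hb with hb | hb
    · exact hq2.not_gt (hb.1.trans hb.2)
    · exact (hq z ⟨hz, hb.1.le⟩).not_gt hb.2

/-- Hanging subtrees can be attached below a new top part, respecting the heap order. -/
theorem exists_graft {N : α → ℕ} {T τ : BinaryTree α} (hτ : IsBST τ) (hτN : IsHeap N τ)
    {R : Set α} (hR : Disjoint R (keys τ))
    (hpart : ∀ C, IsGap (keys τ) R C → ∃ H, IsPart N T C H)
    (hadj : ∀ q ∈ keys τ, ∀ x ∈ R, (∀ z ∈ keys τ, ¬ Between q z x) → N q ≤ N x) :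
    ∃ T₂, IsBST T₂ ∧ IsTop τ T₂ ∧ IsHeap N T₂ ∧ keys T₂ = R ∪ keys τ ∧
      ∀ x ∈ R, leftChild T₂ x = leftChild T x ∧ rightChild T₂ x = rightChild T x := by
  induction τ generalizing R with
  | nil =>
    obtain ⟨H, h⟩ := hpart R ⟨subset_rfl, fun x hx y hy => by simp [hy, keys]⟩
    exact ⟨H, h.bst, trivial, h.heap, by simp [h.keys_eq, keys], h.pointers⟩
  | node a l r ihl ihr =>
    have haR : a ∉ R := fun h => hR.notMem_of_mem_left h (mem_keys_node.2 (.inl rfl))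
    have hlR : ∀ z ∈ keys l, z ∉ R := fun z hz h =>
      hR.notMem_of_mem_left h (mem_keys_node.2 (.inr (.inl hz)))
    have hrR : ∀ z ∈ keys r, z ∉ R := fun z hz h =>
      hR.notMem_of_mem_left h (mem_keys_node.2 (.inr (.inr hz)))
    have hbl : ∀ x y : α, x < a → y < a →
        ((∀ z ∈ keys (.node a l r), ¬ Between x z y) ↔ ∀ z ∈ keys l, ¬ Between x z y) := by
      intro x y hx hy
      refine ⟨fun h z hz => h z (mem_keys_node.2 (by tauto)), fun h z hz => ?_⟩
      rcases mem_keys_node.1 hz with rfl | hz | hz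
      · rintro (h | h); exacts [h.2.not_gt hy, h.2.not_gt hx]
      · exact h z hz
      · have := hτ.2.1 z hz
        rintro (h | h); exacts [(this.trans h.2).not_gt hy, (this.trans h.2).not_gt hx]
    have hbr : ∀ x y : α, a < x → a < y →
        ((∀ z ∈ keys (.node a l r), ¬ Between x z y) ↔ ∀ z ∈ keys r, ¬ Between x z y) := by
      intro x y hx hy
      refine ⟨fun h z hz => h z (mem_keys_node.2 (by tauto)), fun h z hz => ?_⟩
      rcases mem_keys_node.1 hz with rfl | hz | hz
      · rintro (h | h); exacts [h.1.not_gt hx, h.1.not_gt hy]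
      · have := hτ.1 z hz
        rintro (h | h); exacts [(h.1.trans this).not_gt hx, (h.1.trans this).not_gt hy]
      · exact h z hz
    -- A gap of `l` among the elements below `a` is a gap of the whole top part: elements above `a`
    -- are cut off from it by `a` itself.
    obtain ⟨L, hL1, hL2, hL3, hL4, hL5⟩ := ihl (R := {x ∈ R | x < a}) hτ.2.2.1 hτN.2.2.1
      (Set.disjoint_right.2 fun z hz h => hlR z hz h.1)
      (fun C hC => hpart C ⟨fun x hx => (hC.1 hx).1, fun x hx y hy => by
        have hxa := (hC.1 hx).2
        rcases lt_or_ge y a with hya | hya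
        · rw [hC.2 x hx y ⟨hy, hya⟩, hbl x y hxa hya]
        · have hya' : a < y := hya.lt_of_ne (by rintro rfl; exact haR hy)
          refine iff_of_false (fun h => (hC.1 h).2.not_gt hya') fun h => ?_
          exact h a (mem_keys_node.2 (.inl rfl)) (.inl ⟨hxa, hya'⟩)⟩)
      (fun q hq x hx h => hadj q (mem_keys_node.2 (by tauto)) x hx.1
        ((hbl q x (hτ.1 q hq) hx.2).2 h))
    obtain ⟨M, hM1, hM2, hM3, hM4, hM5⟩ := ihr (R := {x ∈ R | a < x}) hτ.2.2.2 hτN.2.2.2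
      (Set.disjoint_right.2 fun z hz h => hrR z hz h.1)
      (fun C hC => hpart C ⟨fun x hx => (hC.1 hx).1, fun x hx y hy => by
        have hxa := (hC.1 hx).2
        rcases lt_or_ge a y with hya | hya
        · rw [hC.2 x hx y ⟨hy, hya⟩, hbr x y hxa hya]
        · have hya' : y < a := hya.lt_of_ne (by rintro rfl; exact haR hy)
          refine iff_of_false (fun h => (hC.1 h).2.not_gt hya') fun h => ?_
          exact h a (mem_keys_node.2 (.inl rfl)) (.inr ⟨hya', hxa⟩)⟩)
      (fun q hq x hx h => hadj q (mem_keys_node.2 (by tauto)) x hx.1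
        ((hbr q x (hτ.2.1 q hq) hx.2).2 h))
    have hNa : ∀ z ∈ keys (.node a l r), N a ≤ N z := by
      intro z hz
      rcases mem_keys_node.1 hz with rfl | hz | hz
      exacts [le_rfl, hτN.1 z hz, hτN.2.1 z hz]
    have hNR : ∀ x ∈ R, N a ≤ N x := fun x hx =>
      IsHeap.le_of_adjacent (finite_keys _) hNa (mem_keys_node.2 (.inl rfl))
        fun q hq h => hadj q hq x hx h
    refine ⟨.node a L M, ⟨fun x hx => ?_, fun x hx => ?_, hL1, hM1⟩, ⟨rfl, hL2, hM2⟩,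
      ⟨fun x hx => ?_, fun x hx => ?_, hL3, hM3⟩, ?_, fun x hx => ?_⟩
    · rw [hL4] at hx; exact hx.elim (fun h => h.2) (hτ.1 x)
    · rw [hM4] at hx; exact hx.elim (fun h => h.2) (hτ.2.1 x)
    · rw [hL4] at hx; exact hx.elim (fun h => hNR x h.1) (hτN.1 x)
    · rw [hM4] at hx; exact hx.elim (fun h => hNR x h.1) (hτN.2.1 x)
    · ext x
      simp only [mem_keys_node, hL4, hM4, Set.mem_union, Set.mem_ofPred_eq]
      rcases lt_trichotomy x a with h | rfl | h
      · simp only [h, h.not_gt, h.ne, and_true, and_false, false_or, or_assoc]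
      · simp
      · simp only [h, h.not_gt, h.ne', and_true, and_false, false_or, or_left_comm]
    · rcases lt_trichotomy x a with h | rfl | h
      · simpa [leftChild, rightChild, h] using hL5 x ⟨hx, h⟩
      · exact absurd hx haR
      · simpa [leftChild, rightChild, h, h.not_gt] using hM5 x ⟨hx, h⟩

end Graft

end GeoBST

namespace GeoBST

/-! ### Lifetimes of the elements -/

section Lifetimes

variable {n m : ℕ} {S : UpdateSeq n m} {K : ℕ → Set (Fin n)} {x : Fin n}

/-- The sets `K 0, K 1, …` evolve by the updates in `S`. -/
def Evolves (S : UpdateSeq n m) (K : ℕ → Set (Fin n)) : Prop :=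
  ∀ (x : Fin n) (t : Fin m),
    x ∈ K (t + 1) ↔ (x, t) ∈ insertPts S ∨ (x ∈ K t ∧ (x, t) ∉ deletePts S)

/-- The set `K i` can be the set of elements just before time `i`, for all `i`. -/
structure Lifetimes (S : UpdateSeq n m) (K : ℕ → Set (Fin n)) : Prop where
  evolves : Evolves S K
  access : ∀ (x : Fin n) (t : Fin m), (x, t) ∈ accessPts S → x ∈ K t
  insert : ∀ (x : Fin n) (t : Fin m), (x, t) ∈ insertPts S → x ∉ K t
  delete : ∀ (x : Fin n) (t : Fin m), (x, t) ∈ deletePts S → x ∈ K t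

theorem notMem_deletePts_of_mem_insertPts {p : Fin n × Fin m} (h : p ∈ insertPts S) :
    p ∉ deletePts S := by
  intro h'
  have := Eq.trans (Eq.symm h) h'
  simp at this

theorem Evolves.mem_iff_of_forall (hK : Evolves S K) {i j : ℕ} (hij : i ≤ j) (hj : j ≤ m)
    (h : ∀ t : Fin m, i ≤ t → t < j → (x, t) ∉ updatePts S) : x ∈ K i ↔ x ∈ K j := by
  induction j, hij using Nat.le_induction with
  | base => rfl
  | succ j hij ih =>
    rw [ih (by omega) fun t h1 h2 => h t h1 (by omega), hK x ⟨j, by omega⟩]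
    have := h ⟨j, by omega⟩ hij (by simp)
    simp only [updatePts, Set.mem_union, not_or] at this
    simp [this]

theorem nearestBelow_or (S : UpdateSeq n m) (x : Fin n) (t : Fin m) :
    (∃ t', NearestBelow S (x, t) (x, t')) ∨ ∀ t' < t, (x, t') ∉ updatePts S := by
  by_cases h : ∃ t' < t, (x, t') ∈ updatePts S
  · left
    obtain ⟨t', ⟨h1, h2⟩, h3⟩ := Set.exists_max_image {t' | t' < t ∧ (x, t') ∈ updatePts S} id
      (Set.toFinite _) h
    refine ⟨t', h2, rfl, h1, ?_⟩
    rintro ⟨y, u⟩ hu rfl hut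
    exact h3 u ⟨hut, hu⟩
  · exact .inr (by simpa using h)

theorem nearestAbove_or (S : UpdateSeq n m) (x : Fin n) (t : Fin m) :
    (∃ t', NearestAbove S (x, t) (x, t')) ∨ ∀ t' > t, (x, t') ∉ updatePts S := by
  by_cases h : ∃ t' > t, (x, t') ∈ updatePts S
  · left
    obtain ⟨t', ⟨h1, h2⟩, h3⟩ := Set.exists_min_image {t' | t < t' ∧ (x, t') ∈ updatePts S} id
      (Set.toFinite _) h
    refine ⟨t', h2, rfl, h1, ?_⟩
    rintro ⟨y, u⟩ hu rfl hut
    exact h3 u ⟨hut, hu⟩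
  · exact .inr (by simpa using h)

theorem Evolves.mem_iff_of_nearestBelow (hK : Evolves S K) {t t' : Fin m}
    (h : NearestBelow S (x, t) (x, t')) : x ∈ K t ↔ (x, t') ∈ insertPts S := by
  obtain ⟨h1, -, h2, h3⟩ := h
  have h2' : (t' : ℕ) < t := h2
  rw [← hK.mem_iff_of_forall (i := t' + 1) (j := t) (by omega) t.2.le, hK x t']
  · rcases h1 with h1 | h1
    · simp [h1]
    · simp [h1]
  · intro u hu hut hux
    have : (u : ℕ) ≤ t' := h3 _ hux rfl hut
    omega

/-- The past of an element determines its presence by evolution alone. Reading presence off the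
future needs consistency: only a present element can be deleted, only an absent one inserted. -/
theorem Lifetimes.mem_iff_of_nearestAbove (hK : Lifetimes S K) {t t' : Fin m}
    (h : NearestAbove S (x, t) (x, t')) : x ∈ K (t + 1) ↔ (x, t') ∈ deletePts S := by
  obtain ⟨h1, -, h2, h3⟩ := h
  have h2' : (t : ℕ) < t' := h2
  rw [hK.evolves.mem_iff_of_forall (i := t + 1) (j := t') (by omega) t'.2.le]
  · rcases h1 with h1 | h1
    · exact iff_of_false (hK.insert x t' h1) (notMem_deletePts_of_mem_insertPts h1)
    · exact iff_of_true (hK.delete x t' h1) h1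
  · intro u hu hut hux
    have : (t' : ℕ) ≤ u := h3 _ hux rfl (show t < u from by omega)
    omega

/-- The nearest updates below and above reveal whether `x` is present just before and just after
time `t`. At a non-update point the two presences agree; at an update exactly one holds. -/
theorem Lifetimes.validPoint_iff (hK : Lifetimes S K) (hS : S.UsesAll) {t : Fin m} :
    ValidPoint S (x, t) ↔ x ∈ K t ∨ x ∈ K (t + 1) := by
  have hbelow : ∀ p', NearestBelow S (x, t) p' → (x ∈ K t ↔ p' ∈ insertPts S) := by
    rintro ⟨y, t'⟩ h
    obtain rfl : y = x := h.2.1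
    exact hK.evolves.mem_iff_of_nearestBelow h
  have habove : ∀ p', NearestAbove S (x, t) p' → (x ∈ K (t + 1) ↔ p' ∈ deletePts S) := by
    rintro ⟨y, t'⟩ h
    obtain rfl : y = x := h.2.1
    exact hK.mem_iff_of_nearestAbove h
  constructor
  · rintro (⟨h, h1, h2⟩ | ⟨h, -⟩ | ⟨h, -⟩)
    · rcases nearestBelow_or S x t with ⟨t', ht'⟩ | hb
      · exact .inl ((hbelow _ ht').2 (h1 _ ht'))
      rcases nearestAbove_or S x t with ⟨t', ht'⟩ | ha
      · exact .inr ((habove _ ht').2 (h2 _ ht'))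
      -- In a column without updates presence is constant, and the element, being used, has an
      -- access, at which it is present.
      have hno : ∀ u, (x, u) ∉ updatePts S := fun u => by
        rcases lt_trichotomy u t with hu | rfl | hu
        exacts [hb u hu, h, ha u hu]
      have hc : ∀ u : Fin m, x ∈ K 0 ↔ x ∈ K u := fun u =>
        hK.evolves.mem_iff_of_forall (Nat.zero_le _) u.2.le fun v _ _ => hno v
      obtain ⟨u, hu⟩ := hS x
      have hux : x ∈ K u := by
        refine hK.access x u (Prod.ext hu ?_)
        cases ho : (S u).2 with
        | access => rfl
        | insert => exact absurd (.inl (Prod.ext hu ho)) (hno u)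
        | delete => exact absurd (.inr (Prod.ext hu ho)) (hno u)
      exact .inl ((hc t).1 ((hc u).2 hux))
    · exact .inr ((hK.evolves x t).2 (.inl h))
    · exact .inl (hK.delete x t h)
  · intro h
    by_cases hi : (x, t) ∈ insertPts S
    · have h1 := hK.insert x t hi
      have h2 : x ∈ K (t + 1) := (hK.evolves x t).2 (.inl hi)
      refine .inr (.inl ⟨hi, fun p' hp' => ?_, fun p' hp' => (habove p' hp').1 h2⟩)
      exact hp'.1.resolve_left fun h => h1 ((hbelow p' hp').2 h)
    by_cases hd : (x, t) ∈ deletePts S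
    · have h1 := hK.delete x t hd
      have h2 : x ∉ K (t + 1) := fun h => ((hK.evolves x t).1 h).elim hi fun h => h.2 hd
      refine .inr (.inr ⟨hd, fun p' hp' => (hbelow p' hp').1 h1, fun p' hp' => ?_⟩)
      exact hp'.1.resolve_right fun h => h2 ((habove p' hp').2 h)
    · have h2 : x ∈ K (t + 1) ↔ x ∈ K t := by rw [hK.evolves x t]; simp [hi, hd]
      have h1 : x ∈ K t := h.elim id h2.1
      exact .inl ⟨fun h => h.elim hi hd, fun p' hp' => (hbelow p' hp').1 h1,
        fun p' hp' => (habove p' hp').1 (h2.2 h1)⟩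

theorem Lifetimes.notMem_succ_of_delete (hK : Lifetimes S K) {t : Fin m}
    (h : (x, t) ∈ deletePts S) : x ∉ K (t + 1) := fun h' =>
  ((hK.evolves x t).1 h').elim (fun hi => notMem_deletePts_of_mem_insertPts hi h)
    fun h' => h'.2 h

/-- Index `i` means just before time `i`, so the range runs from just after time `p.2` to just
before time `q.2`. An insertion at `p.2` and a deletion at `q.2` are thereby allowed. -/
theorem Lifetimes.activePair_iff (hK : Lifetimes S K) (hS : S.UsesAll) {p q : Fin n × Fin m}
    (hpq : p.2 < q.2) :
    ActivePair S p q ↔ ∀ i : ℕ, p.2 < i → i ≤ q.2 → p.1 ∈ K i ∧ q.1 ∈ K i := by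
  have hpq' : (p.2 : ℕ) < q.2 := hpq
  have hrun : ∀ (x : Fin n) (a b t : Fin m), ActiveRun S x a b → a < t → t ≤ b → x ∈ K t := by
    intro x a b t hr hat htb
    obtain ⟨h1, h2, -⟩ := hr t ⟨hat.le, htb⟩
    rcases (hK.validPoint_iff hS).1 h1 with h | h
    · exact h
    · exact ((hK.evolves x t).1 h).elim (fun h => absurd (h2 h) hat.ne') fun h => h.1
  have hact : ∀ x : Fin n, (∀ i : ℕ, p.2 < i → i ≤ q.2 → x ∈ K i) →
      ActiveRun S x p.2 q.2 := by
    intro x hx t ht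
    have h1 : (p.2 : ℕ) ≤ t := ht.1
    have h2 : (t : ℕ) ≤ q.2 := ht.2
    refine ⟨(hK.validPoint_iff hS).2 ?_, fun h => ?_, fun h => ?_⟩
    · rcases h1.lt_or_eq with h1 | h1
      · exact .inl (hx t h1 h2)
      · exact .inr (hx (t + 1) (by omega) (by omega))
    · by_contra hne
      exact hK.insert x t h (hx t (by have : (t : ℕ) ≠ p.2 := fun h => hne (Fin.ext h)
                                      omega) h2)
    · by_contra hne
      exact hK.notMem_succ_of_delete h (hx (t + 1) (by omega)
        (by have : (t : ℕ) ≠ q.2 := fun h => hne (Fin.ext h)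
            omega))
  constructor
  · rintro ⟨-, h1, h2⟩ i hpi hiq
    have hi : i < m := hiq.trans_lt q.2.2
    have hmem : (⟨i, hi⟩ : Fin m) ∈ Set.Icc p.2 q.2 := ⟨hpi.le, hiq⟩
    obtain ⟨a, b, hr, hp, ht⟩ := h1 hmem
    obtain ⟨c, d, hs, hq, hu⟩ := h2 (show p.2 ∈ Set.Icc p.2 q.2 from ⟨le_rfl, hpq.le⟩)
    exact ⟨hrun _ a b ⟨i, hi⟩ hr (hp.1.trans_lt hpi) ht.2,
      hrun _ c d ⟨i, hi⟩ hs (hu.1.trans_lt hpi) (hmem.2.trans hq.2)⟩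
  · intro h
    exact ⟨hpq.le, fun t ht => ⟨_, _, hact p.1 fun i hi hi' => (h i hi hi').1,
      ⟨le_rfl, hpq.le⟩, ht⟩, fun t ht => ⟨_, _, hact q.1 fun i hi hi' => (h i hi hi').2,
      ⟨hpq.le, le_rfl⟩, ht⟩⟩

end Lifetimes

/-! ### The points of an execution -/

section ExecutionPoints

theorem ValidReconfiguration.mem_left {α : Type*} [LinearOrder α] {T₁ τ τ' T₂ : BinaryTree α}
    (h : ValidReconfiguration T₁ τ τ' T₂) {x : α} (hx : x ∈ keys τ') (hx1 : x ∈ keys T₁) :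
    x ∈ keys τ := by
  rcases h.elements with h | ⟨y, hy, h⟩ | ⟨y, hy, h⟩
  · rwa [← h]
  · rw [h] at hx
    exact hx.resolve_left (by rintro rfl; exact hy hx1)
  · rw [h]; exact .inr hx

theorem ValidReconfiguration.mem_right {α : Type*} [LinearOrder α] {T₁ τ τ' T₂ : BinaryTree α}
    (h : ValidReconfiguration T₁ τ τ' T₂) {x : α} (hx : x ∈ keys τ) (hx2 : x ∈ keys T₂) :
    x ∈ keys τ' := by
  rw [h.keys_right] at hx2
  exact hx2.resolve_left fun h => h.2 hx

variable {n m : ℕ} {S : UpdateSeq n m}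

theorem lifetimes_of_reconfigurations {K : ℕ → Set (Fin n)} {T : Fin (m + 1) → BinaryTree (Fin n)}
    {τ τ' : Fin m → BinaryTree (Fin n)} (hK : ∀ i : Fin (m + 1), K i = keys (T i))
    (hV : ∀ t : Fin m, ValidReconfiguration (T t.castSucc) (τ t) (τ' t) (T t.succ))
    (hP : ∀ t : Fin m, Performs (τ t) (τ' t) (S t).1 (S t).2) : Lifetimes S K := by
  have hK1 : ∀ t : Fin m, K t = keys (T t.castSucc) := fun t => hK t.castSucc
  have hK2 : ∀ t : Fin m, K (t + 1) = keys (T t.succ) := fun t => hK t.succ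
  have hins : ∀ x t, (x, t) ∈ insertPts S → x ∉ keys (T t.castSucc) := by
    intro x t h hx
    have hp := hP t
    rw [show S t = _ from h] at hp
    -- `Performs` only keeps the inserted element out of the touched part; its absence from the
    -- whole tree follows because a reconfiguration adds only elements that are new.
    exact hp.1 ((hV t).mem_left (by rw [hp.2]; exact .inl rfl) hx)
  have hdel : ∀ x t, (x, t) ∈ deletePts S → x ∈ keys (T t.castSucc) := by
    intro x t h
    have hp := hP t
    rw [show S t = _ from h] at hp
    exact (hV t).top_left.keys_subset (by rw [hp.2]; exact .inl rfl)
  refine ⟨fun x t => ?_, fun x t h => ?_, fun x t h => hK1 t ▸ hins x t h,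
    fun x t h => hK1 t ▸ hdel x t h⟩
  · have hp := hP t
    have hsub := (hV t).top_left.keys_subset
    have hi := hins x t
    have hd := hdel x t
    rw [hK1, hK2, (hV t).keys_right]
    rcases hs : S t with ⟨s, _ | _ | _⟩ <;> rw [hs] at hp <;> obtain ⟨hp1, hp2⟩ := hp <;>
      simp only [insertPts, deletePts, Set.mem_ofPred_eq, hs, Prod.mk.injEq, reduceCtorEq, and_false,
        and_true, false_or, not_false_eq_true, Set.mem_union, Set.mem_sdiff]
    · rw [hp2]; have := @hsub x; tauto
    · rw [hp2, Set.mem_insert_iff]; have := @hsub x; have : x = s ↔ s = x := eq_comm; tauto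
    · have : x ∈ keys (τ t) ↔ x = s ∨ x ∈ keys (τ' t) := by rw [hp2]; rfl
      have h2 := @hsub x; have h3 : x = s ↔ s = x := eq_comm
      have h4 : s = x → x ∉ keys (τ' t) := by rintro rfl; exact hp1
      tauto
  · have hp := hP t
    rw [show S t = _ from h] at hp
    rw [hK1]
    exact (hV t).top_left.keys_subset hp.1

theorem Execution.Executes.satisfied {E : Execution n m} (hE : E.Executes S) (hS : S.UsesAll) :
    Satisfied S E.points := by
  obtain ⟨T, -, hT, hE⟩ := hE
  have hV := fun t => (hE t).1
  have hP := fun t => (hE t).2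
  -- The default `∅` beyond index `m` is never consulted.
  obtain ⟨K, hKT⟩ : ∃ K : ℕ → Set (Fin n), ∀ i : Fin (m + 1), K i = keys (T i) :=
    ⟨fun i => if h : i < m + 1 then keys (T ⟨i, h⟩) else ∅, fun i => dif_pos i.2⟩
  have hK := lifetimes_of_reconfigurations hKT hV hP
  have hK1 : ∀ t : Fin m, K t = keys (T t.castSucc) := fun t => hKT t.castSucc
  have hK2 : ∀ t : Fin m, K (t + 1) = keys (T t.succ) := fun t => hKT t.succ
  have hpt : ∀ {x t}, (x, t) ∈ E.points ↔ x ∈ keys (E.before t) ∨ x ∈ keys (E.after t) := Iff.rfl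
  have hbefore : ∀ {x t}, (x, t) ∈ E.points → x ∈ K t → x ∈ keys (E.before t) := fun h h' =>
    h.elim id fun h => (hV _).mem_left h (hK1 _ ▸ h')
  have hafter : ∀ {x t}, (x, t) ∈ E.points → x ∈ K (t + 1) → x ∈ keys (E.after t) := fun h h' =>
    h.elim (fun h => (hV _).mem_right h (hK2 _ ▸ h')) id
  have hseq : seqPts S ⊆ E.points := by
    rintro ⟨x, t⟩ h
    have hp := hP t
    rcases h with (h | h) | h <;> rw [show S t = _ from h] at hp
    · exact .inl hp.1
    · exact .inr (by rw [hp.2]; exact .inl rfl)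
    · exact .inl (by rw [hp.2]; exact .inl rfl)
  refine ⟨⟨hseq, ?_⟩, ?_, ?_⟩
  · rintro ⟨x, t⟩ h
    rw [hK.validPoint_iff hS, hK1, hK2]
    exact h.imp (fun h => (hV t).top_left.keys_subset h) (fun h => (hV t).top_right.keys_subset h)
  · rintro ⟨x, a⟩ hp ⟨y, b⟩ hq hpq
    by_cases hab : a = b
    · exact .inr (.inl hab)
    by_cases hxy : x = y
    · exact .inl hxy
    refine .inr (.inr ?_)
    have hlt : a < b := lt_of_le_of_ne hpq.1 hab
    have hlt' : (a : ℕ) < b := hlt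
    have hal : ∀ i : ℕ, a < i → i ≤ b → x ∈ K i ∧ y ∈ K i := (hK.activePair_iff hS hlt).1 hpq
    obtain ⟨hx1, hy1⟩ := hal (a + 1) (by omega) (by omega)
    have hrect : ∀ z t, z ∈ Set.uIcc x y → a ≤ t → t ≤ b → (z, t) ∈ rect (x, a) (y, b) :=
      fun z t hz h1 h2 => ⟨hz, by rw [Set.uIcc_of_le hlt.le]; exact ⟨h1, h2⟩⟩
    -- The common ancestor is taken just after time `a`, when both elements are present; as an
    -- ancestor of the touched `x`, it is touched at time `a`.
    obtain ⟨z, hz, hzxy, hzx, hzy⟩ :=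
      exists_anc_mem_uIcc (hT a.succ) (hK2 a ▸ hx1) (hK2 a ▸ hy1)
    have hza := (hV a).top_right.mem_of_anc (hT _) hzx (hafter hp hx1)
    by_cases hzx' : z = x
    · subst hzx'
      by_cases hex : ∃ t, a < t ∧ t < b ∧ (z, t) ∈ E.points
      · obtain ⟨t, h1, h2, h3⟩ := hex
        refine ⟨(z, t), ⟨⟨hrect z t hzxy h1.le h2.le, h3⟩, ?_⟩, fun h => absurd h h1.ne',
          fun h => absurd h h2.ne⟩
        simp [h1.ne', h2.ne]
      -- As long as `z = x` is untouched it keeps its descendant `y`, so touching `y` at time `b`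
      -- also touches `z`.
      · have hanc : ∀ i (hi : i < m + 1), a < i → i ≤ b → Anc (T ⟨i, hi⟩) z y := by
          intro i hi hai
          induction i, hai using Nat.le_induction with
          | base => exact fun _ => hzy
          | succ i hai ih =>
            intro hib
            have hi' : i < m := by omega
            refine (hV ⟨i, hi'⟩).anc_right ?_ (fun h => hex ⟨⟨i, hi'⟩, ?_, ?_, .inl h⟩)
              (ih (by omega) (by omega))
            · exact hK1 ⟨i, hi'⟩ ▸ (hal i hai (by omega)).1
            · exact hai
            · exact Nat.lt_of_succ_le hib
        have hb := hal b hlt' le_rfl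
        refine ⟨(z, b), ⟨⟨hrect z b hzxy hlt.le le_rfl, .inl ?_⟩, ?_⟩,
          fun h => absurd h (Ne.symm hab), fun _ h => hK.insert z b h hb.1⟩
        · exact (hV b).top_left.mem_of_anc (hT _) (hanc b (by omega) hlt' le_rfl)
            (hbefore hq hb.2)
        · simp [Ne.symm hab, hxy]
    · refine ⟨(z, a), ⟨⟨hrect z a hzxy le_rfl hlt.le, .inr hza⟩, ?_⟩,
        fun _ h => hK.notMem_succ_of_delete h (hK2 a ▸ hz), fun h => absurd h hab⟩
      simp [hzx', hab]
  · rintro ⟨s, t⟩ hp ⟨x, t1⟩ ⟨y, t2⟩ ⟨hx1, rfl, hxs, hx⟩ ⟨hy1, ht, hsy, hy⟩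
    obtain rfl : t2 = t1 := ht
    simp only at hx hy hxs hsy
    by_contra! hcon
    obtain ⟨hxP, hyP⟩ := hcon
    rw [hpt, not_or] at hxP hyP
    have hmem : ∀ z, z ≠ s → ValidPoint S (z, t2) → z ∈ K t2 ∧ z ∈ K (t2 + 1) := by
      intro z hz hv
      have hno : (z, t2) ∉ insertPts S ∧ (z, t2) ∉ deletePts S := by
        refine ⟨fun h => ?_, fun h => ?_⟩ <;> rcases hp with hp | hp <;>
        · have := Eq.trans (Eq.symm h) hp
          simp [hz] at this
      have := hK.evolves z t2
      simp only [hno, not_false_eq_true, and_true, false_or] at this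
      have := (hK.validPoint_iff hS).1 hv
      tauto
    have hxK := hmem x hxs.ne hx1
    have hyK := hmem y hsy.ne' hy1
    -- Apart from `s`, the only valid points of the row between pred and succ are these two; so
    -- their common ancestor, in a tree without `s`, is one of them.
    have hbetween : ∀ z, z ≠ s → z ∈ Set.uIcc x y → ValidPoint S (z, t2) → z = x ∨ z = y := by
      intro z hzs hz hv
      rw [Set.uIcc_of_le (hxs.trans hsy).le] at hz
      rcases lt_or_gt_of_ne hzs with h | h
      · exact .inl (le_antisymm (hx z h hv) hz.1)
      · exact .inr (le_antisymm hz.2 (hy z h hv))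
    have hsxy : s ∈ Set.uIcc x y := by
      rw [Set.uIcc_of_le (hxs.trans hsy).le]; exact ⟨hxs.le, hsy.le⟩
    have hP2 := hP t2
    rcases hp with hp | hp <;> rw [show S t2 = _ from hp] at hP2
    · obtain ⟨z, hz, hzxy, hzx, hzy⟩ := exists_anc_mem_uIcc (hT t2.castSucc)
        (hK1 t2 ▸ hxK.1) (hK1 t2 ▸ hyK.1)
      have hzK : z ∈ K t2 := hK1 t2 ▸ hz
      have hsτ : s ∈ keys (E.after t2) := by rw [hP2.2]; exact .inl rfl
      -- An untouched `z` keeps its descendant `w` across the insertion. Descendants form an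
      -- interval, so `s` ends up below `z`, and touching `s` would touch `z`.
      have key : ∀ w, z ∉ keys (E.before t2) → z ∉ keys (E.after t2) → z ∈ K (t2 + 1) →
          Anc (T t2.castSucc) z w → s ∈ Set.uIcc z w → False := by
        intro w h1 h2 h3 h4 h5
        refine h2 ((hV t2).top_right.mem_of_anc (hT _)
          (((hV t2).anc_right hz h1 h4).of_mem_uIcc (hT _) (hK2 t2 ▸ h3)
            ((hV t2).top_right.keys_subset hsτ) h5) hsτ)
      rcases hbetween z (by rintro rfl; exact hK.insert _ _ hp hzK) hzxy
        ((hK.validPoint_iff hS).2 (.inl hzK)) with rfl | rfl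
      · exact key y hxP.1 hxP.2 hxK.2 hzy hsxy
      · exact key x hyP.1 hyP.2 hyK.2 hzx (Set.uIcc_comm x z ▸ hsxy)
    -- A deletion is an insertion with time reversed: the common ancestor is taken in the tree after
    -- it.
    · obtain ⟨z, hz, hzxy, hzx, hzy⟩ := exists_anc_mem_uIcc (hT t2.succ)
        (hK2 t2 ▸ hxK.2) (hK2 t2 ▸ hyK.2)
      have hzK : z ∈ K (t2 + 1) := hK2 t2 ▸ hz
      have hsτ : s ∈ keys (E.before t2) := by rw [hP2.2]; exact .inl rfl
      have key : ∀ w, z ∉ keys (E.before t2) → z ∉ keys (E.after t2) → z ∈ K t2 →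
          Anc (T t2.succ) z w → s ∈ Set.uIcc z w → False := by
        intro w h1 h2 h3 h4 h5
        refine h1 ((hV t2).top_left.mem_of_anc (hT _)
          (((hV t2).anc_left hz h2 h4).of_mem_uIcc (hT _) (hK1 t2 ▸ h3)
            ((hV t2).top_left.keys_subset hsτ) h5) hsτ)
      rcases hbetween z (by rintro rfl; exact hK.notMem_succ_of_delete hp hzK) hzxy
        ((hK.validPoint_iff hS).2 (.inr hzK)) with rfl | rfl
      · exact key y hxP.1 hxP.2 hxK.1 hzy hsxy
      · exact key x hyP.1 hyP.2 hyK.1 hzx (Set.uIcc_comm x z ▸ hsxy)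

end ExecutionPoints

end GeoBST

namespace GeoBST

/-! ### From a satisfied point set to an execution -/

section Construction

variable {n m : ℕ} {S : UpdateSeq n m}

/-- The elements just before time `i`, as determined by the update sequence. -/
def aliveAt (S : UpdateSeq n m) : ℕ → Set (Fin n)
  | 0 => {x | ∀ t, (x, t) ∈ updatePts S → (∀ u < t, (x, u) ∉ updatePts S) → (x, t) ∈ deletePts S}
  | i + 1 => {x | (∃ t : Fin m, t.val = i ∧ (x, t) ∈ insertPts S) ∨
      (x ∈ aliveAt S i ∧ ∀ t : Fin m, t.val = i → (x, t) ∉ deletePts S)}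

theorem evolves_aliveAt (S : UpdateSeq n m) : Evolves S (aliveAt S) := by
  intro x t
  have h1 : (∃ u : Fin m, u.val = t ∧ (x, u) ∈ insertPts S) ↔ (x, t) ∈ insertPts S :=
    ⟨fun ⟨u, hu, h⟩ => Fin.ext hu ▸ h, fun h => ⟨t, rfl, h⟩⟩
  have h2 : (∀ u : Fin m, u.val = t → (x, u) ∉ deletePts S) ↔ (x, t) ∉ deletePts S :=
    ⟨fun h => h t rfl, fun h u hu => Fin.ext hu ▸ h⟩
  rw [← h1, ← h2]
  rfl

theorem notMem_updatePts_of_mem_accessPts {p : Fin n × Fin m} (h : p ∈ accessPts S) :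
    p ∉ updatePts S := by
  rintro (h' | h') <;> · have := Eq.trans (Eq.symm h) h'; simp at this

/-- Validity of the nearest update below a point forces the right presence. If there is none, the
initial set decides: it contains exactly the elements whose first update, if any, is a deletion. -/
theorem lifetimes_aliveAt (hS : ∀ p ∈ seqPts S, ValidPoint S p) : Lifetimes S (aliveAt S) := by
  have hK := evolves_aliveAt S
  have hzero : ∀ {x : Fin n} {t : Fin m}, (∀ u < t, (x, u) ∉ updatePts S) →
      (x ∈ aliveAt S 0 ↔ x ∈ aliveAt S t) := fun {x t} h =>
    hK.mem_iff_of_forall (Nat.zero_le _) t.2.le fun u _ hu => h u hu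
  refine ⟨hK, fun x t h => ?_, fun x t h => ?_, fun x t h => ?_⟩
  · have hu := notMem_updatePts_of_mem_accessPts h
    have hv := hS _ (.inl (.inl h))
    obtain ⟨-, h1, h2⟩ := hv.resolve_right
      (by rintro (h | h); exacts [hu (.inl h.1), hu (.inr h.1)])
    rcases nearestBelow_or S x t with ⟨t', ht'⟩ | hb
    · exact (hK.mem_iff_of_nearestBelow ht').2 (h1 _ ht')
    · refine (hzero hb).1 fun t0 ht0 hfirst => h2 _ ⟨ht0, rfl, ?_, ?_⟩
      · rcases lt_trichotomy t0 t with h | rfl | h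
        exacts [absurd ht0 (hb t0 h), absurd ht0 hu, h]
      · rintro ⟨y, u⟩ hyu rfl -
        exact not_lt.1 fun h => hfirst u h hyu
  · have hv := hS _ (.inl (.inr h))
    have h1 : ∀ p', NearestBelow S (x, t) p' → p' ∈ deletePts S := by
      rcases hv with hv | hv | hv
      exacts [absurd (.inl h) hv.1, hv.2.1, absurd hv.1 (notMem_deletePts_of_mem_insertPts h)]
    intro hx
    rcases nearestBelow_or S x t with ⟨t', ht'⟩ | hb
    · exact notMem_deletePts_of_mem_insertPts ((hK.mem_iff_of_nearestBelow ht').1 hx) (h1 _ ht')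
    · exact notMem_deletePts_of_mem_insertPts h ((hzero hb).2 hx t (.inl h) hb)
  · have hv := hS _ (.inr h)
    have h1 : ∀ p', NearestBelow S (x, t) p' → p' ∈ insertPts S := by
      rcases hv with hv | hv | hv
      exacts [absurd (.inr h) hv.1, absurd h (notMem_deletePts_of_mem_insertPts hv.1), hv.2.1]
    rcases nearestBelow_or S x t with ⟨t', ht'⟩ | hb
    · exact (hK.mem_iff_of_nearestBelow ht').2 (h1 _ ht')
    · refine (hzero hb).1 fun t0 ht0 hfirst => ?_
      rcases lt_trichotomy t0 t with h' | rfl | h'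
      exacts [absurd ht0 (hb t0 h'), h, absurd (.inr h) (hfirst t h')]

/-- The element `x` is touched at time `i`. -/
def Touched (P : Set (Fin n × Fin m)) (x : Fin n) (i : ℕ) : Prop := ∃ h : i < m, (x, ⟨i, h⟩) ∈ P

/-- The first time from `i` on at which `x` is touched, or at least `m` if there is none. -/
noncomputable def nextTouch (P : Set (Fin n × Fin m)) (i : ℕ) (x : Fin n) : ℕ :=
  sInf {j | i ≤ j ∧ (Touched P x j ∨ m ≤ j)}

section NextTouch

variable {P : Set (Fin n × Fin m)} {x : Fin n} {i j : ℕ}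

theorem touched_coe {t : Fin m} : Touched P x t ↔ (x, t) ∈ P := ⟨fun h => h.2, fun h => ⟨t.2, h⟩⟩

theorem nextTouch_mem (P : Set (Fin n × Fin m)) (i : ℕ) (x : Fin n) :
    i ≤ nextTouch P i x ∧ (Touched P x (nextTouch P i x) ∨ m ≤ nextTouch P i x) :=
  Nat.sInf_mem (s := {j | i ≤ j ∧ (Touched P x j ∨ m ≤ j)})
    ⟨max i m, le_max_left _ _, .inr (le_max_right _ _)⟩

theorem nextTouch_le (hij : i ≤ j) (h : Touched P x j) : nextTouch P i x ≤ j :=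
  Nat.sInf_le ⟨hij, .inl h⟩

theorem nextTouch_le_of_le (hi : i ≤ m) : nextTouch P i x ≤ m :=
  Nat.sInf_le ⟨hi, .inr le_rfl⟩

/-- Untouched elements keep their priority from one step to the next, so hanging subtrees remain
heap-ordered. -/
theorem nextTouch_succ (hi : i < m) (h : ¬ Touched P x i) :
    nextTouch P i x = nextTouch P (i + 1) x := by
  unfold nextTouch
  congr 1
  ext j
  simp only [Set.mem_ofPred_eq]
  constructor
  · rintro ⟨h1, h2⟩
    refine ⟨Nat.succ_le_of_lt (lt_of_le_of_ne h1 ?_), h2⟩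
    rintro rfl
    exact h2.elim h hi.not_ge
  · rintro ⟨h1, h2⟩
    exact ⟨by omega, h2⟩

theorem nextTouch_le_self_iff {t : Fin m} : nextTouch P t x ≤ t ↔ (x, t) ∈ P := by
  refine ⟨fun h => ?_, fun h => nextTouch_le le_rfl (touched_coe.2 h)⟩
  obtain ⟨h1, h2⟩ := nextTouch_mem P t x
  rw [le_antisymm h h1] at h2
  exact touched_coe.1 (h2.resolve_right t.2.not_ge)

end NextTouch

/-! ### Touch times in satisfied sets, and the step of the construction. -/

variable {P : Set (Fin n × Fin m)} {K : ℕ → Set (Fin n)}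

theorem Lifetimes.mem_iff_mem_succ (hK : Lifetimes S K) {x : Fin n} {t : Fin m}
    (h : (x, t) ∉ updatePts S) : x ∈ K t ↔ x ∈ K (t + 1) := by
  rw [hK.evolves x t]
  simp only [updatePts, Set.mem_union, not_or] at h
  simp [h]

theorem ValidSet.mem_of_mem_updatePts (hP : ValidSet S P) {p : Fin n × Fin m}
    (h : p ∈ updatePts S) : p ∈ P :=
  hP.1 (h.elim (fun h => .inl (.inr h)) .inr)

theorem eq_of_mem_updatePts {x y : Fin n} {t : Fin m} (hx : (x, t) ∈ updatePts S)
    (hy : (y, t) ∈ updatePts S) : x = y := by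
  have h : ∀ z, (z, t) ∈ updatePts S → (S t).1 = z := by
    rintro z (h | h) <;> rw [show S t = _ from h]
  rw [← h x hx, ← h y hy]

/-- Between two untouched elements on different sides of an updated one there is another touched
element. -/
theorem Satisfied.exists_touched_between (hP : Satisfied S P) (hS : S.UsesAll)
    (hK : Lifetimes S K) {s x y : Fin n} {t : Fin m} (hs : (s, t) ∈ updatePts S)
    (hx : x ∈ K t) (hy : y ∈ K t) (hxP : (x, t) ∉ P) (hyP : (y, t) ∉ P) (h : Between x s y) :
    ∃ z, z ≠ s ∧ (z, t) ∈ P ∧ z ∈ K t ∧ Between x z y := by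
  wlog hxy : x < y generalizing x y
  · obtain ⟨z, h1, h2, h3, h4⟩ := this hy hx hyP hxP (Or.symm h)
      (by rcases h with h | h
          · exact absurd (h.1.trans h.2) hxy
          · exact h.1.trans h.2)
    exact ⟨z, h1, h2, h3, h4.symm⟩
  obtain ⟨hxs, hsy⟩ : x < s ∧ s < y :=
    h.resolve_right fun h => (h.1.trans h.2).not_gt hxy
  have hvx : ValidPoint S (x, t) := (hK.validPoint_iff hS).2 (.inl hx)
  have hvy : ValidPoint S (y, t) := (hK.validPoint_iff hS).2 (.inl hy)
  have hmem : ∀ z, z ≠ s → ValidPoint S (z, t) → z ∈ K t := fun z hz hv => by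
    rcases (hK.validPoint_iff hS).1 hv with h | h
    · exact h
    · exact (hK.mem_iff_mem_succ fun h => hz (eq_of_mem_updatePts h hs)).2 h
  -- Here `a` and `b` are pred and succ of the updated element. Condition 2 touches one of them, and
  -- it differs from the untouched `x` and `y`.
  obtain ⟨a, ⟨ha1, ha2⟩, ha⟩ := Set.exists_max_image {z | z < s ∧ ValidPoint S (z, t)} id
    (Set.toFinite _) ⟨x, hxs, hvx⟩
  obtain ⟨b, ⟨hb1, hb2⟩, hb⟩ := Set.exists_min_image {z | s < z ∧ ValidPoint S (z, t)} id
    (Set.toFinite _) ⟨y, hsy, hvy⟩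
  have hxa : x ≤ a := ha x ⟨hxs, hvx⟩
  have hby : b ≤ y := hb y ⟨hsy, hvy⟩
  rcases hP.2.2 (s, t) hs (a, t) (b, t) ⟨ha2, rfl, ha1, fun z h1 h2 => ha z ⟨h1, h2⟩⟩
    ⟨hb2, rfl, hb1, fun z h1 h2 => hb z ⟨h1, h2⟩⟩ with h | h
  · refine ⟨a, ha1.ne, h, hmem a ha1.ne ha2, .inl ⟨hxa.lt_of_ne ?_, ha1.trans hsy⟩⟩
    rintro rfl; exact hxP h
  · refine ⟨b, hb1.ne', h, hmem b hb1.ne' hb2, .inl ⟨hxs.trans hb1, hby.lt_of_ne ?_⟩⟩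
    rintro rfl; exact hyP ‹_›

theorem between_trans {x y z w : Fin n} (h : Between x z y) (h' : Between x w z) :
    Between x w y := by
  unfold Between at *; omega

theorem between_of_mem_uIcc {x y z : Fin n} (h : z ∈ Set.uIcc x y) (hx : z ≠ x) (hy : z ≠ y) :
    Between x z y := by
  rw [Set.mem_uIcc] at h
  unfold Between; omega

/-- An untouched element is not touched again before the touched elements next to it. -/
theorem Satisfied.nextTouch_le_nextTouch (hP : Satisfied S P) (hS : S.UsesAll)
    (hK : Lifetimes S K) {t : Fin m} {q r : Fin n} (hq : q ∈ K (t + 1)) (hqP : (q, t) ∈ P)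
    (hr : r ∈ K (t + 1)) (hrP : (r, t) ∉ P)
    (hqr : ∀ z ∈ K (t + 1), (z, t) ∈ P → ¬ Between q z r) :
    nextTouch P (t + 1) q ≤ nextTouch P (t + 1) r := by
  -- Induction on the horizontal distance: if `r` were touched before `q`, a closer element `w`
  -- would be too.
  induction hd : ((q : ℤ) - r).natAbs using Nat.strong_induction_on generalizing r with
  | _ d ih =>
  by_contra! hlt
  have hup : ∀ {z : Fin n} {u : Fin m}, (z, u) ∈ updatePts S → (z, u) ∈ P :=
    fun h => hP.1.mem_of_mem_updatePts h
  obtain ⟨b, hb⟩ : ∃ b : Fin m, nextTouch P (t + 1) r = b :=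
    ⟨⟨_, hlt.trans_le (nextTouch_le_of_le t.2)⟩, rfl⟩
  rw [hb] at hlt
  have hrb := nextTouch_mem P (t + 1) r
  rw [hb] at hrb
  obtain ⟨htb, hrb⟩ := hrb
  replace hrb : (r, b) ∈ P := touched_coe.1 (hrb.resolve_right b.2.not_ge)
  have hqno : ∀ u : Fin m, (t : ℕ) + 1 ≤ u → (u : ℕ) ≤ b → (q, u) ∉ P := fun u h1 h2 h =>
    (nextTouch_le h1 (touched_coe.2 h)).not_gt (by omega)
  have hrno : ∀ u : Fin m, (t : ℕ) + 1 ≤ u → (u : ℕ) < b → (r, u) ∉ P := fun u h1 h2 h =>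
    (nextTouch_le h1 (touched_coe.2 h)).not_gt (by omega)
  have hqK : ∀ i : ℕ, (t : ℕ) < i → i ≤ b → q ∈ K i := fun i h1 h2 =>
    (hK.evolves.mem_iff_of_forall h1 (h2.trans b.2.le) fun u h3 h4 h5 =>
      hqno u h3 (by omega) (hup h5)).1 hq
  have hrK : ∀ i : ℕ, (t : ℕ) < i → i ≤ b → r ∈ K i := fun i h1 h2 =>
    (hK.evolves.mem_iff_of_forall h1 (h2.trans b.2.le) fun u h3 h4 h5 =>
      hrno u h3 (by omega) (hup h5)).1 hr
  have hmem : ∀ {z : Fin n} {u : Fin m}, (z, u) ∈ P → (z, u) ∉ insertPts S → z ∈ K u := by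
    intro z u h1 h2
    rcases (hK.validPoint_iff hS).1 (hP.1.2 _ h1) with h | h
    · exact h
    · exact (((hK.evolves z u).1 h).resolve_left h2).1
  -- Condition 1 for `(q, t)` and `(r, b)` yields a touched point strictly between the two columns;
  -- `u₀` is the lowest row after `t` holding an admissible one.
  obtain ⟨u₀, w₀, ⟨hu₀, hu₀b, hw₀, hw₀P, hw₀I⟩, hmin⟩ : ∃ (u : Fin m) (w : Fin n),
      (t < u ∧ u ≤ b ∧ Between q w r ∧ (w, u) ∈ P ∧ (u = b → (w, u) ∉ insertPts S)) ∧
      ∀ v : Fin m, t < v → v < u → ∀ z, Between q z r → (z, v) ∉ P := by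
    obtain ⟨u, ⟨hu1, hu2, w, hw⟩, hmin⟩ := Set.exists_min_image
      {u : Fin m | t < u ∧ u ≤ b ∧
        ∃ w, Between q w r ∧ (w, u) ∈ P ∧ (u = b → (w, u) ∉ insertPts S)} id (Set.toFinite _) <| by
      have hact : ActivePair S (q, t) (r, b) := (hK.activePair_iff hS (show t < b from htb)).2
        fun i h1 h2 => ⟨hqK i h1 h2, hrK i h1 h2⟩
      have htb' : t < b := htb
      rcases hP.2.1 (q, t) hqP (r, b) hrb hact with h | h | ⟨⟨w, u⟩, ⟨⟨⟨hw, hu⟩, hwP⟩, h1⟩, h2⟩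
      · exact absurd ((show q = r from h) ▸ hqP) hrP
      · exact absurd h htb'.ne
      · simp only [Set.mem_insert_iff, Set.mem_singleton_iff, Prod.mk.injEq, not_or] at h1
        obtain ⟨hu1, hu2⟩ : t ≤ u ∧ u ≤ b := by
          rwa [Set.uIcc_of_le htb'.le] at hu
        have hu1' : (t : ℕ) ≤ u := hu1
        have hu2' : (u : ℕ) ≤ b := hu2
        have hwq : w ≠ q := by
          rintro rfl
          have hne : (u : ℕ) ≠ t := fun h => h1.1 ⟨rfl, Fin.ext h⟩
          exact hqno u (by omega) hu2' hwP
        have hwr : w ≠ r := by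
          rintro rfl
          have hne : (u : ℕ) ≠ b := fun h => h1.2 ⟨rfl, Fin.ext h⟩
          rcases hu1.lt_or_eq with h | h
          · exact hrno u h (by omega) hwP
          · exact hrP (h ▸ hwP)
        have hbt := between_of_mem_uIcc hw hwq hwr
        rcases hu1.lt_or_eq with h | rfl
        · exact ⟨u, h, hu2, w, hbt, hwP, h2.2⟩
        -- The point cannot lie in row `t`: not being a deletion, it would be a touched element
        -- still present, separating `q` from `r`.
        · refine absurd hbt (hqr w ?_ hwP)
          by_cases hi : (w, t) ∈ insertPts S
          · exact (hK.evolves w t).2 (.inl hi)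
          · exact (hK.evolves w t).2 (.inr ⟨hmem hwP hi, h2.1 rfl⟩)
    refine ⟨u, w, ⟨hu1, hu2, hw⟩, fun v h1 h2 z hz hzP => (hmin v ?_).not_gt h2⟩
    exact ⟨h1, h2.le.trans hu2, z, hz, hzP, fun h => absurd h (h2.trans_le hu2).ne⟩
  have hu₀' : (t : ℕ) < u₀ := hu₀
  have hu₀b' : (u₀ : ℕ) ≤ b := hu₀b
  obtain ⟨w, hw, hwP, hwK⟩ : ∃ w, Between q w r ∧ (w, u₀) ∈ P ∧ w ∈ K u₀ := by
    -- An inserted `w₀` was not present before and is no use for the induction. Condition 1 excludes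
    -- insertions in row `b`, so `u₀ < b` and `r` is untouched there too; condition 2 then supplies
    -- another touched element, already present.
    by_cases hi : (w₀, u₀) ∈ insertPts S
    · have hlt : (u₀ : ℕ) < b :=
        lt_of_le_of_ne hu₀b' fun h => hw₀I (Fin.ext h) hi
      obtain ⟨z, -, h1, h2, h3⟩ := hP.exists_touched_between hS hK (.inl hi)
        (hqK u₀ hu₀' hu₀b') (hrK u₀ hu₀' hu₀b') (hqno u₀ hu₀' hu₀b') (hrno u₀ hu₀' hlt) hw₀
      exact ⟨z, h3, h1, h2⟩
    · exact ⟨w₀, hw₀, hw₀P, hmem hw₀P hi⟩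
  -- By minimality of `u₀`, the column of `w` has no update between `t` and `u₀`.
  have hwK' : w ∈ K (t + 1) := (hK.evolves.mem_iff_of_forall hu₀' u₀.2.le fun v h1 h2 h3 =>
    hmin v h1 h2 w hw (hup h3)).2 hwK
  have hle := ih _ (by unfold Between at hw; omega) hwK' (fun h => hqr w hwK' h hw)
    (fun z hz hzP hb => hqr z hz hzP (between_trans hw hb)) rfl
  have := nextTouch_le (P := P) (i := t + 1) hu₀' (touched_coe.2 hwP)
  omega

/-- The treap invariant is carried over time `t`. The old top part consists of the present elements
with next touch time `t`; the new one is a treap, for the next touch times after `t`, on the touched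
elements that remain or arrive. -/
theorem Satisfied.exists_reconfiguration (hP : Satisfied S P) (hS : S.UsesAll)
    (hK : Lifetimes S K) (t : Fin m) {T : BinaryTree (Fin n)} (hT : IsBST T)
    (hTK : keys T = K t) (hTN : IsHeap (nextTouch P t) T) :
    ∃ τ τ' T₂, ValidReconfiguration T τ τ' T₂ ∧ Performs τ τ' (S t).1 (S t).2 ∧
      keys τ ∪ keys τ' = {x | (x, t) ∈ P} ∧
      IsBST T₂ ∧ keys T₂ = K (t + 1) ∧ IsHeap (nextTouch P (t + 1)) T₂ := by
  obtain ⟨τ, hτ, hτk⟩ := hTN.exists_isTop t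
  replace hτk : ∀ x, x ∈ keys τ ↔ x ∈ K t ∧ (x, t) ∈ P := fun x => by
    rw [hτk, hTK, Set.mem_ofPred_eq, nextTouch_le_self_iff]
  obtain ⟨τ', hτ', hτk', hτN'⟩ := exists_isBST_isHeap (nextTouch P (t + 1))
    (Set.toFinite {x | x ∈ K (t + 1) ∧ (x, t) ∈ P}).toFinset
  replace hτk' : ∀ x, x ∈ keys τ' ↔ x ∈ K (t + 1) ∧ (x, t) ∈ P := fun x => by simp [hτk']
  have hup : ∀ {z : Fin n} {u : Fin m}, (z, u) ∈ updatePts S → (z, u) ∈ P :=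
    fun h => hP.1.mem_of_mem_updatePts h
  have hR : ∀ x, x ∈ keys T \ keys τ ↔ x ∈ K t ∧ (x, t) ∉ P := fun x => by
    rw [Set.mem_sdiff, hTK, hτk]; tauto
  have hR' : ∀ x, x ∈ keys T \ keys τ ↔ x ∈ K (t + 1) ∧ (x, t) ∉ P := fun x => by
    rw [hR]
    exact and_congr_left fun h => hK.mem_iff_mem_succ fun h' => h (hup h')
  -- The old and new top parts differ at most in the updated element. If it separates two untouched
  -- elements, condition 2 provides a separator in both parts, so the gaps do not change.
  have hbetween : ∀ x y, x ∈ keys T \ keys τ → y ∈ keys T \ keys τ →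
      ((∀ z ∈ keys τ, ¬ Between x z y) ↔ ∀ z ∈ keys τ', ¬ Between x z y) := by
    intro x y hx hy
    rw [hR] at hx hy
    have key : ∀ z, (z, t) ∈ P → Between x z y →
        ∃ w, w ∈ keys τ ∧ w ∈ keys τ' ∧ Between x w y := by
      intro z hz hxz
      by_cases hu : (z, t) ∈ updatePts S
      · obtain ⟨w, h1, h2, h3, h4⟩ :=
          hP.exists_touched_between hS hK hu hx.1 hy.1 hx.2 hy.2 hxz
        exact ⟨w, (hτk w).2 ⟨h3, h2⟩, (hτk' w).2 ⟨(hK.mem_iff_mem_succ fun h =>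
          h1 (eq_of_mem_updatePts h hu)).1 h3, h2⟩, h4⟩
      · have h1 := hK.mem_iff_mem_succ hu
        have h2 := (hK.validPoint_iff hS).1 (hP.1.2 _ hz)
        exact ⟨z, (hτk z).2 ⟨by tauto, hz⟩, (hτk' z).2 ⟨by tauto, hz⟩, hxz⟩
    constructor
    · intro h z hz hb
      obtain ⟨w, h1, -, h3⟩ := key z ((hτk' z).1 hz).2 hb
      exact h w h1 h3
    · intro h z hz hb
      obtain ⟨w, -, h2, h3⟩ := key z ((hτk z).1 hz).2 hb
      exact h w h2 h3
  obtain ⟨T₂, h1, h2, h3, h4, h5⟩ := exists_graft (N := nextTouch P (t + 1)) (T := T) hτ' hτN'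
    (R := keys T \ keys τ)
    (Set.disjoint_left.2 fun x hx hx' => ((hR x).1 hx).2 ((hτk' x).1 hx').2)
    (fun C hC => by
      obtain ⟨H, h⟩ := hτ.exists_isPart hT hTN (C := C) ⟨hC.1, fun x hx y hy => by
        rw [hbetween x y (hC.1 hx) hy]; exact hC.2 x hx y hy⟩
      refine ⟨H, h.bst, h.keys_eq, h.heap.congr fun x hx => ?_, h.pointers⟩
      rw [h.keys_eq] at hx
      exact nextTouch_succ t.2 fun h => ((hR x).1 (hC.1 hx)).2 (touched_coe.1 h))
    (fun q hq x hx hno => hP.nextTouch_le_nextTouch hS hK ((hτk' q).1 hq).1 ((hτk' q).1 hq).2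
      ((hR' x).1 hx).1 ((hR' x).1 hx).2 fun z hz hzP => hno z ((hτk' z).2 ⟨hz, hzP⟩))
  have hseq : (S t = ((S t).1, .access) ∧ keys τ' = keys τ ∧ (S t).1 ∈ keys τ) ∨
      (S t = ((S t).1, .insert) ∧ keys τ' = insert (S t).1 (keys τ) ∧ (S t).1 ∉ keys T) ∨
      (S t = ((S t).1, .delete) ∧ keys τ = insert (S t).1 (keys τ') ∧ (S t).1 ∉ keys τ') := by
    have hx : ∀ x, x ≠ (S t).1 → (x ∈ K t ↔ x ∈ K (t + 1)) := fun x hx =>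
      hK.mem_iff_mem_succ fun h => hx <| by
        rcases h with h | h <;> rw [show S t = _ from h]
    cases ho : (S t).2 with
    | access =>
      have hmem : ((S t).1, t) ∈ accessPts S := Prod.ext rfl ho
      refine .inl ⟨Prod.ext rfl ho, ?_, ?_⟩
      · ext x
        rw [hτk, hτk', ← hK.mem_iff_mem_succ]
        intro h
        have : x = (S t).1 := by rcases h with h | h <;> rw [show S t = _ from h]
        exact notMem_updatePts_of_mem_accessPts hmem (this ▸ h)
      · exact (hτk _).2 ⟨hK.access _ t hmem, hP.1.1 (.inl (.inl hmem))⟩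
    | insert =>
      have hmem : ((S t).1, t) ∈ insertPts S := Prod.ext rfl ho
      have hs := hK.insert _ t hmem
      refine .inr (.inl ⟨Prod.ext rfl ho, ?_, hTK ▸ hs⟩)
      ext x
      rw [Set.mem_insert_iff, hτk, hτk']
      by_cases hxs : x = (S t).1
      · rw [hxs]
        exact iff_of_true ⟨(hK.evolves _ t).2 (.inl hmem), hup (.inl hmem)⟩ (.inl rfl)
      · simp [hxs, hx x hxs]
    | delete =>
      have hmem : ((S t).1, t) ∈ deletePts S := Prod.ext rfl ho
      have hs := hK.notMem_succ_of_delete hmem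
      refine .inr (.inr ⟨Prod.ext rfl ho, ?_, fun h => hs ((hτk' _).1 h).1⟩)
      ext x
      rw [Set.mem_insert_iff, hτk, hτk']
      by_cases hxs : x = (S t).1
      · rw [hxs]
        exact iff_of_true ⟨hK.delete _ t hmem, hup (.inr hmem)⟩ (.inl rfl)
      · simp [hxs, hx x hxs]
  refine ⟨τ, τ', T₂, ⟨hT, h1, hτ, h2, ?_, h4, h5⟩, ?_, ?_, h1, ?_, h3⟩
  · rcases hseq with h | h | h
    exacts [.inl h.2.1, .inr (.inl ⟨_, h.2.2, h.2.1⟩), .inr (.inr ⟨_, h.2.2, h.2.1⟩)]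
  · rcases hseq with ⟨h, h'⟩ | ⟨h, h'⟩ | ⟨h, h'⟩ <;> rw [h]
    exacts [⟨h'.2, h'.1⟩, ⟨fun h => h'.2 (hτ.keys_subset h), h'.1⟩, ⟨h'.2, h'.1⟩]
  · ext x
    rw [Set.mem_union, hτk, hτk', Set.mem_ofPred_eq]
    refine ⟨fun h => h.elim And.right And.right, fun h => ?_⟩
    exact ((hK.validPoint_iff hS).1 (hP.1.2 _ h)).imp (⟨·, h⟩) (⟨·, h⟩)
  · ext x
    rw [h4, Set.mem_union, hR', hτk']; tauto

theorem Satisfied.exists_execution (hP : Satisfied S P) (hS : S.UsesAll) :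
    ∃ E : Execution n m, E.Executes S ∧ E.points = P := by
  have hK := lifetimes_aliveAt fun p hp => hP.1.2 p (hP.1.1 hp)
  let Good : ℕ → BinaryTree (Fin n) → Prop := fun i T =>
    IsBST T ∧ keys T = aliveAt S i ∧ IsHeap (nextTouch P i) T
  have hstep : ∀ (t : Fin m) (T : BinaryTree (Fin n)), Good t T → ∃ τ τ' T₂,
      ValidReconfiguration T τ τ' T₂ ∧ Performs τ τ' (S t).1 (S t).2 ∧
      keys τ ∪ keys τ' = {x | (x, t) ∈ P} ∧ Good (t + 1) T₂ := fun t T hT =>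
    hP.exists_reconfiguration hS hK t hT.1 hT.2.1 hT.2.2
  -- The chosen functions are total; only their values at trees satisfying the invariant matter.
  choose! τ τ' next hV hPf hpts hnext using hstep
  obtain ⟨T₀, hT₀⟩ : ∃ T₀, Good 0 T₀ := by
    obtain ⟨T, h1, h2, h3⟩ := exists_isBST_isHeap (nextTouch P 0)
      (Set.toFinite (aliveAt S 0)).toFinset
    exact ⟨T, h1, by simpa using h2, h3⟩
  let T : Fin (m + 1) → BinaryTree (Fin n) := Fin.induction T₀ fun t T => next t T
  have hTs : ∀ t : Fin m, T t.succ = next t (T t.castSucc) := fun t => Fin.induction_succ ..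
  have hT : ∀ i : Fin (m + 1), Good i (T i) := by
    intro i
    induction i using Fin.induction with
    | zero => exact hT₀
    | succ t ih => rw [hTs]; exact hnext t _ ih
  refine ⟨⟨T₀, fun t => τ t (T t.castSucc), fun t => τ' t (T t.castSucc)⟩,
    ⟨T, rfl, fun i => (hT i).1, fun t => ⟨?_, hPf t _ (hT t.castSucc)⟩⟩, ?_⟩
  · rw [hTs]; exact hV t _ (hT t.castSucc)
  · ext ⟨x, t⟩
    exact Set.ext_iff.1 (hpts t _ (hT t.castSucc)) x

end Construction

end GeoBST

theorem mainTheorem4 (n m : ℕ) (S : GeoBST.UpdateSeq n m) (hS : S.UsesAll)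
    (P : Set (Fin n × Fin m)) :
    GeoBST.Satisfied S P ↔
      ∃ E : GeoBST.Execution n m, E.Executes S ∧ E.points = P := by
  constructor
  · exact fun h => h.exists_execution hS
  · rintro ⟨E, hE, rfl⟩
    exact hE.satisfied hS
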